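/- Let $m \ge 2$ and $N > 2m$ be integers, and let $P$ be a real polynomial on $\mathbb{R}^N$ of degree at most $2m-2$ such that $P(x)/\ln|x| \to +\infty$ as $|x| \to \infty$. Then there exists $C_P \in \mathbb{R}$ such that for every $C \ge C_P$ there is a classical solution $u \in C^{2m}(\mathbb{R}^N)$ of $(-\Delta)^m u = e^u$ in $\mathbb{R}^N$ with $$-P(x) - C \le u(x) \le -P(x) - C + (1+|x|^2)^{m - N/2} \quad \text{for all } x \in \mathbb{R}^N. \tag{$*$}$$ Moreover, there exists $\widetilde C_P \ge C_P$ such that for every $C \ge \widetilde C_P$, every such solution $u$ (that is, every classical solution satisfying $(*)$ with this $C$) is stable in $\mathbb{R}^N$, which means that for every $\varphi \in C_0^\infty(\mathbb{R}^N)$, $$\int_{\mathbb{R}^N} |\Delta^{m/2}\varphi|^2\,dx - \int_{\mathbb{R}^N} e^u \varphi^2\,dx \ge 0 \ \text{ if } m \text{ is even}, \qquad \int_{\mathbb{R}^N} |\nabla(\Delta^{(m-1)/2}\varphi)|^2\,dx - \int_{\mathbb{R}^N} e^u \varphi^2\,dx \ge 0 \ \text{ if } m \text{ is odd}.$$ 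-/

import Mathlib

open scoped ContDiff

noncomputable section

/-- The Euclidean space `ℝ^N`, with the Euclidean norm. -/
abbrev RN (N : ℕ) : Type := EuclideanSpace ℝ (Fin N)

/-- The iterated Laplacian `Δ^k u` on `ℝ^N`. -/
def iterLaplacian {N : ℕ} (k : ℕ) (u : RN N → ℝ) : RN N → ℝ :=
  (fun v : RN N → ℝ => (Laplacian.laplacian v : RN N → ℝ))^[k] u

/-- The polyharmonic operator `(-Δ)^m u` on `ℝ^N`. -/
def polyharmonic {N : ℕ} (m : ℕ) (u : RN N → ℝ) : RN N → ℝ :=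
  (fun v : RN N → ℝ => -(Laplacian.laplacian v : RN N → ℝ))^[m] u

/-- `u` is an entire classical solution of `(-Δ)^m u = e^u` in `ℝ^N`: it is of class `C^{2m}` and
the equation holds at every point. -/
structure IsEntireSolution {N : ℕ} (m : ℕ) (u : RN N → ℝ) : Prop where
  contDiff : ContDiff ℝ ((2 * m : ℕ) : WithTop ℕ∞) u
  eqn : ∀ x : RN N, polyharmonic m u x = Real.exp (u x)

/-- `φ` is a test function on `Ω`, that is `φ ∈ C_0^∞(Ω)`: smooth, with compact support
contained in `Ω`. -/
structure IsTestFunction {N : ℕ} (Ω : Set (RN N)) (φ : RN N → ℝ) : Prop where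
  contDiff : ContDiff ℝ ∞ φ
  hasCompactSupport : HasCompactSupport φ
  tsupport_subset : tsupport φ ⊆ Ω

/-- The energy `∫_Ω |Δ^{m/2} φ|²` for even `m`, and `∫_Ω |∇(Δ^{(m-1)/2} φ)|²` for odd `m`. -/
def polyEnergy {N : ℕ} (m : ℕ) (Ω : Set (RN N)) (φ : RN N → ℝ) : ℝ :=
  if Even m then ∫ x in Ω, |iterLaplacian (m / 2) φ x| ^ 2
  else ∫ x in Ω, ‖gradient (iterLaplacian ((m - 1) / 2) φ) x‖ ^ 2

/-- Stability in `Ω` of a solution `u` of `(-Δ)^m u = e^u`. -/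
def IsStableIn {N : ℕ} (m : ℕ) (u : RN N → ℝ) (Ω : Set (RN N)) : Prop :=
  ∀ φ : RN N → ℝ, IsTestFunction Ω φ →
    0 ≤ polyEnergy m Ω φ - ∫ x in Ω, Real.exp (u x) * φ x ^ 2

/-- The value at `x ∈ ℝ^N` of a real polynomial in `N` variables. -/
def polyValue {N : ℕ} (P : MvPolynomial (Fin N) ℝ) (x : RN N) : ℝ :=
  MvPolynomial.eval (fun i => x i) P

/-- The two-sided bound `-P - C ≤ u ≤ -P - C + (1 + |x|²)^{m - N/2}` on `ℝ^N`. -/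
def IsTrapped {N : ℕ} (m : ℕ) (P : MvPolynomial (Fin N) ℝ) (C : ℝ) (u : RN N → ℝ) : Prop :=
  ∀ x : RN N, -polyValue P x - C ≤ u x ∧
    u x ≤ -polyValue P x - C + (1 + ‖x‖ ^ 2) ^ ((m : ℝ) - (N : ℝ) / 2)

end

/-! Write u = -P - C + v. Since P + C has degree below 2m, it is annihilated by (-Δ)^m, so the
equation becomes (-Δ)^m v = e^{-C} e^{-P} e^v. The growth of P makes e^{-P} decay faster than every
power.

Existence. With s = N/2 - m, a multiple of |x|^{-2s} is a fundamental solution of (-Δ)^m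
(`conv_bubble_zero_polyharmonic`), and it suffices to solve v = κ |x|^{-2s} * (e^{-C} e^{-P} e^v).
The potential of a rapidly decaying function is O((1 + |x|²)^{-s})
(`exists_abs_conv_bubble_zero_le`), which is the barrier in the statement. The factor e^{-C} makes
the right side a contraction with values below the barrier once C is large
(`exists_fixedPoint_conv`). Each convolution gains a derivative, so the fixed point is smooth and
solves the equation classically (`isEntireSolution_of_fixedPoint`).

The singular kernel is handled through the smooth functions (|x|² + τ)^{-s}. Their image under
(-Δ)^m is exactly a constant times τ^m (|x|² + τ)^{-s-2m} (`polyharmonic_bubble`), an approximate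
identity up to a constant as τ → 0.

Stability. The upper bound gives e^u ≤ e^{1-C} e^{-P}, at most a constant times e^{-C} (1 +
|x|²)^{-m}. A Hardy–Rellich inequality with weight (1 + |x|²)^{-m}, valid for N > 2m
(`exists_integral_bubble_mul_sq_le_polyEnergy`), absorbs this potential into the energy for C large,
uniformly in u. -/

section

open scoped ContDiff
open MeasureTheory Filter Topology
open Laplacian

variable {N : ℕ}

/-! ### Partial derivatives, growth and decay classes -/

/-- The partial derivative of `f` in the `i`-th coordinate. -/
noncomputable def pd (i : Fin N) (f : RN N → ℝ) : RN N → ℝ :=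
  fun x => fderiv ℝ f x (EuclideanSpace.single i 1)

/-- `f` is bounded by a multiple of `(1 + ‖x‖) ^ p`. -/
def HasGrowth (p : ℝ) (f : RN N → ℝ) : Prop :=
  ∃ C : ℝ, ∀ x, |f x| ≤ C * (1 + ‖x‖) ^ p

/-- Polynomial growth. -/
def IsSlow (f : RN N → ℝ) : Prop := ∃ p, HasGrowth p f

/-- Decay faster than every power. -/
def IsRapid (f : RN N → ℝ) : Prop := ∀ p, HasGrowth p f

/-- All partial derivatives of order at most `k` exist, are continuous and lie in `B`. -/
def SmoothClass (B : (RN N → ℝ) → Prop) : ℕ → (RN N → ℝ) → Prop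
  | 0, f => Continuous f ∧ B f
  | k + 1, f => (Differentiable ℝ f ∧ B f) ∧ ∀ i, SmoothClass B k (pd i f)

lemma fderiv_apply_eq_sum_pd {f : RN N → ℝ} (x y : RN N) :
    fderiv ℝ f x y = ∑ i, y i * pd i f x := by
  have h := (EuclideanSpace.basisFun (Fin N) ℝ).sum_repr y
  conv_lhs => rw [← h]
  simp [pd, map_sum]

lemma norm_fderiv_le_sum_pd {f : RN N → ℝ} (x : RN N) :
    ‖fderiv ℝ f x‖ ≤ ∑ i, |pd i f x| := by
  refine ContinuousLinearMap.opNorm_le_bound _ (Finset.sum_nonneg fun i _ => abs_nonneg _) ?_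
  intro y
  rw [fderiv_apply_eq_sum_pd, Finset.sum_mul]
  refine (norm_sum_le _ _).trans (Finset.sum_le_sum fun i _ => ?_)
  rw [norm_mul, mul_comm]
  gcongr
  · exact le_rfl
  · exact PiLp.norm_apply_le y i

lemma one_le_one_add_norm (x : RN N) : 1 ≤ 1 + ‖x‖ := by linarith [norm_nonneg x]

lemma one_add_norm_pos (x : RN N) : 0 < 1 + ‖x‖ := by linarith [norm_nonneg x]

lemma HasGrowth.exists_nonneg {p : ℝ} {f : RN N → ℝ} (h : HasGrowth p f) :
    ∃ C : ℝ, 0 ≤ C ∧ ∀ x, |f x| ≤ C * (1 + ‖x‖) ^ p := by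
  obtain ⟨C, hC⟩ := h
  refine ⟨|C|, abs_nonneg C, fun x => (hC x).trans ?_⟩
  gcongr
  exact le_abs_self C

lemma HasGrowth.add {p : ℝ} {f g : RN N → ℝ} (hf : HasGrowth p f) (hg : HasGrowth p g) :
    HasGrowth p (fun x => f x + g x) := by
  obtain ⟨C, hC⟩ := hf
  obtain ⟨D, hD⟩ := hg
  exact ⟨C + D, fun x => (abs_add_le _ _).trans (by linarith [hC x, hD x])⟩

lemma HasGrowth.mul {p r : ℝ} {f g : RN N → ℝ} (hf : HasGrowth p f) (hg : HasGrowth r g) :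
    HasGrowth (p + r) (fun x => f x * g x) := by
  obtain ⟨C, hC0, hC⟩ := hf.exists_nonneg
  obtain ⟨D, hD0, hD⟩ := hg.exists_nonneg
  refine ⟨C * D, fun x => ?_⟩
  rw [abs_mul, Real.rpow_add (one_add_norm_pos x)]
  calc |f x| * |g x| ≤ (C * (1 + ‖x‖) ^ p) * (D * (1 + ‖x‖) ^ r) := by
        gcongr
        · exact hC x
        · exact hD x
    _ = _ := by ring

lemma HasGrowth.mono {p r : ℝ} (hpr : p ≤ r) {f : RN N → ℝ} (hf : HasGrowth p f) :
    HasGrowth r f := by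
  obtain ⟨C, hC0, hC⟩ := hf.exists_nonneg
  refine ⟨C, fun x => (hC x).trans ?_⟩
  gcongr
  exact one_le_one_add_norm x

lemma HasGrowth.of_abs_le {p : ℝ} {f g : RN N → ℝ} (hg : HasGrowth p g)
    (h : ∀ x, |f x| ≤ |g x|) : HasGrowth p f := by
  obtain ⟨C, hC⟩ := hg
  exact ⟨C, fun x => (h x).trans (hC x)⟩

lemma IsSlow.add {f g : RN N → ℝ} (hf : IsSlow f) (hg : IsSlow g) :
    IsSlow (fun x => f x + g x) := by
  obtain ⟨p, hp⟩ := hf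
  obtain ⟨r, hr⟩ := hg
  exact ⟨max p r, (hp.mono (le_max_left _ _)).add (hr.mono (le_max_right _ _))⟩

lemma IsSlow.mul {f g : RN N → ℝ} (hf : IsSlow f) (hg : IsSlow g) :
    IsSlow (fun x => f x * g x) := by
  obtain ⟨p, hp⟩ := hf
  obtain ⟨r, hr⟩ := hg
  exact ⟨p + r, hp.mul hr⟩

lemma IsRapid.add {f g : RN N → ℝ} (hf : IsRapid f) (hg : IsRapid g) :
    IsRapid (fun x => f x + g x) := fun p => (hf p).add (hg p)

lemma IsRapid.isSlow {f : RN N → ℝ} (hf : IsRapid f) : IsSlow f := ⟨0, hf 0⟩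

lemma IsRapid.mul_slow {f g : RN N → ℝ} (hf : IsRapid f) (hg : IsSlow g) :
    IsRapid (fun x => f x * g x) := by
  obtain ⟨r, hr⟩ := hg
  intro p
  simpa using (hf (p - r)).mul hr

lemma IsSlow.mul_rapid {f g : RN N → ℝ} (hf : IsSlow f) (hg : IsRapid g) :
    IsRapid (fun x => f x * g x) := by
  simpa only [mul_comm] using hg.mul_slow hf

lemma isSlow_const (c : ℝ) : IsSlow (fun _ : RN N => c) := ⟨0, |c|, fun x => by simp⟩

lemma isRapid_zero : IsRapid (fun _ : RN N => (0 : ℝ)) := fun p => ⟨0, fun x => by simp⟩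

lemma isSlow_coord (i : Fin N) : IsSlow (fun x : RN N => x i) := by
  refine ⟨1, 1, fun x => ?_⟩
  rw [Real.rpow_one, one_mul]
  exact (PiLp.norm_apply_le x i).trans (by linarith)

section pd

variable {f g : RN N → ℝ}

lemma pd_add (hf : Differentiable ℝ f) (hg : Differentiable ℝ g) (i : Fin N) :
    pd i (fun x => f x + g x) = fun x => pd i f x + pd i g x := by
  funext x
  simp [pd, fderiv_fun_add (hf x) (hg x)]

lemma pd_mul (hf : Differentiable ℝ f) (hg : Differentiable ℝ g) (i : Fin N) :
    pd i (fun x => f x * g x) = fun x => f x * pd i g x + pd i f x * g x := by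
  funext x
  simp [pd, fderiv_fun_mul (hf x) (hg x), mul_comm]

@[simp] lemma pd_const (c : ℝ) (i : Fin N) : pd i (fun _ : RN N => c) = fun _ => 0 := by
  funext x
  simp [pd]

lemma pd_const_mul (hf : Differentiable ℝ f) (c : ℝ) (i : Fin N) :
    pd i (fun x => c * f x) = fun x => c * pd i f x := by
  rw [pd_mul (differentiable_const c) hf]
  simp

lemma pd_coord (i j : Fin N) :
    pd i (fun x : RN N => x j) = fun _ => if j = i then 1 else 0 := by
  funext x
  have : HasFDerivAt (fun x : RN N => x j) (EuclideanSpace.proj j : RN N →L[ℝ] ℝ) x :=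
    (EuclideanSpace.proj j : RN N →L[ℝ] ℝ).hasFDerivAt
  simp [pd, this.fderiv]

lemma differentiable_coord (j : Fin N) : Differentiable ℝ (fun x : RN N => x j) :=
  (EuclideanSpace.proj j : RN N →L[ℝ] ℝ).differentiable

end pd

namespace SmoothClass

variable {B B₁ B₂ B₃ : (RN N → ℝ) → Prop} {f g : RN N → ℝ} {k : ℕ}

lemma prop (h : SmoothClass B k f) : B f := by
  cases k with
  | zero => exact h.2
  | succ k => exact h.1.2

lemma continuous (h : SmoothClass B k f) : Continuous f := by
  cases k with
  | zero => exact h.1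
  | succ k => exact h.1.1.continuous

lemma differentiable (h : SmoothClass B (k + 1) f) : Differentiable ℝ f := h.1.1

lemma pd (h : SmoothClass B (k + 1) f) (i : Fin N) : SmoothClass B k (pd i f) := h.2 i

lemma of_succ (h : SmoothClass B (k + 1) f) : SmoothClass B k f := by
  induction k generalizing f with
  | zero => exact ⟨h.continuous, h.prop⟩
  | succ k ih => exact ⟨h.1, fun i => ih (h.2 i)⟩

lemma of_le {l : ℕ} (h : SmoothClass B k f) (hl : l ≤ k) : SmoothClass B l f := by
  induction k with
  | zero => obtain rfl : l = 0 := by omega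
            exact h
  | succ k ih =>
    rcases Nat.lt_or_ge k l with h1 | h1
    · obtain rfl : l = k + 1 := by omega
      exact h
    · exact ih h.of_succ h1

lemma imp (hB : ∀ f, B₁ f → B₂ f) (h : SmoothClass B₁ k f) : SmoothClass B₂ k f := by
  induction k generalizing f with
  | zero => exact ⟨h.1, hB _ h.2⟩
  | succ k ih => exact ⟨⟨h.1.1, hB _ h.1.2⟩, fun i => ih (h.2 i)⟩

lemma add (hB : ∀ f g, B f → B g → B (fun x => f x + g x))
    (hf : SmoothClass B k f) (hg : SmoothClass B k g) :
    SmoothClass B k (fun x => f x + g x) := by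
  induction k generalizing f g with
  | zero => exact ⟨hf.1.add hg.1, hB _ _ hf.2 hg.2⟩
  | succ k ih =>
    refine ⟨⟨hf.1.1.add hg.1.1, hB _ _ hf.1.2 hg.1.2⟩, fun i => ?_⟩
    rw [pd_add hf.1.1 hg.1.1]
    exact ih (hf.2 i) (hg.2 i)

/-- Leibniz rule and induction on k. Three separate predicates let one proof serve both slow times
slow and rapid times slow. -/
lemma mul (hadd : ∀ f g, B₃ f → B₃ g → B₃ (fun x => f x + g x))
    (hmul : ∀ f g, B₁ f → B₂ g → B₃ (fun x => f x * g x))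
    (hf : SmoothClass B₁ k f) (hg : SmoothClass B₂ k g) :
    SmoothClass B₃ k (fun x => f x * g x) := by
  induction k generalizing f g with
  | zero => exact ⟨hf.1.mul hg.1, hmul _ _ hf.2 hg.2⟩
  | succ k ih =>
    refine ⟨⟨hf.1.1.mul hg.1.1, hmul _ _ hf.1.2 hg.1.2⟩, fun i => ?_⟩
    rw [pd_mul hf.1.1 hg.1.1]
    exact add hadd (ih hf.of_succ (hg.2 i)) (ih (hf.2 i) hg.of_succ)

lemma contDiff (h : SmoothClass B k f) : ContDiff ℝ k f := by
  induction k generalizing f with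
  | zero => exact contDiff_zero.2 h.1
  | succ k ih =>
    push_cast
    rw [contDiff_succ_iff_fderiv_apply]
    refine ⟨h.1.1, by simp, fun y => ?_⟩
    simp_rw [fderiv_apply_eq_sum_pd]
    exact ContDiff.sum fun i _ => contDiff_const.mul (ih (h.2 i))

end SmoothClass

/-- `f` has polynomial growth together with its derivatives of order at most `k`. -/
abbrev SlowSmooth (k : ℕ) (f : RN N → ℝ) : Prop := SmoothClass IsSlow k f

/-- `f` decays rapidly together with its derivatives of order at most `k`. -/
abbrev RapidSmooth (k : ℕ) (f : RN N → ℝ) : Prop := SmoothClass IsRapid k f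

section classes

variable {f g : RN N → ℝ} {k : ℕ}

lemma SlowSmooth.add (hf : SlowSmooth k f) (hg : SlowSmooth k g) :
    SlowSmooth k (fun x => f x + g x) := SmoothClass.add (fun _ _ => IsSlow.add) hf hg

lemma RapidSmooth.add (hf : RapidSmooth k f) (hg : RapidSmooth k g) :
    RapidSmooth k (fun x => f x + g x) := SmoothClass.add (fun _ _ => IsRapid.add) hf hg

lemma SlowSmooth.mul (hf : SlowSmooth k f) (hg : SlowSmooth k g) :
    SlowSmooth k (fun x => f x * g x) :=
  SmoothClass.mul (fun _ _ => IsSlow.add) (fun _ _ => IsSlow.mul) hf hg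

lemma RapidSmooth.mul_slow (hf : RapidSmooth k f) (hg : SlowSmooth k g) :
    RapidSmooth k (fun x => f x * g x) :=
  SmoothClass.mul (fun _ _ => IsRapid.add) (fun _ _ => IsRapid.mul_slow) hf hg

lemma RapidSmooth.slow (hf : RapidSmooth k f) : SlowSmooth k f :=
  SmoothClass.imp (fun _ => IsRapid.isSlow) hf

lemma rapidSmooth_zero : RapidSmooth k (fun _ : RN N => (0 : ℝ)) := by
  induction k with
  | zero => exact ⟨continuous_const, isRapid_zero⟩
  | succ k ih => exact ⟨⟨differentiable_const _, isRapid_zero⟩, fun i => by simpa using ih⟩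

lemma slowSmooth_const (c : ℝ) : SlowSmooth k (fun _ : RN N => c) := by
  induction k generalizing c with
  | zero => exact ⟨continuous_const, isSlow_const c⟩
  | succ k ih => exact ⟨⟨differentiable_const _, isSlow_const c⟩, fun i => by simpa using ih 0⟩

lemma slowSmooth_coord (i : Fin N) : SlowSmooth k (fun x : RN N => x i) := by
  cases k with
  | zero => exact ⟨(differentiable_coord i).continuous, isSlow_coord i⟩
  | succ k =>
    refine ⟨⟨differentiable_coord i, isSlow_coord i⟩, fun j => ?_⟩
    rw [pd_coord]
    exact slowSmooth_const _

lemma RapidSmooth.const_mul (c : ℝ) (hf : RapidSmooth k f) :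
    RapidSmooth k (fun x => c * f x) := by
  simpa only [mul_comm] using hf.mul_slow (slowSmooth_const c)

lemma SlowSmooth.const_mul (c : ℝ) (hf : SlowSmooth k f) :
    SlowSmooth k (fun x => c * f x) := (slowSmooth_const c).mul hf

lemma RapidSmooth.neg (hf : RapidSmooth k f) : RapidSmooth k (fun x => - f x) := by
  simpa using hf.const_mul (-1)

lemma SlowSmooth.neg (hf : SlowSmooth k f) : SlowSmooth k (fun x => - f x) := by
  simpa using hf.const_mul (-1)

lemma RapidSmooth.sum {ι : Type*} (s : Finset ι) {F : ι → RN N → ℝ}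
    (h : ∀ i ∈ s, RapidSmooth k (F i)) : RapidSmooth k (fun x => ∑ i ∈ s, F i x) := by
  classical
  induction s using Finset.induction_on with
  | empty => simpa using rapidSmooth_zero
  | insert a s ha ih =>
    simp_rw [Finset.sum_insert ha]
    exact (h a (by simp)).add (ih fun i hi => h i (by simp [hi]))

lemma SlowSmooth.sum {ι : Type*} (s : Finset ι) {F : ι → RN N → ℝ}
    (h : ∀ i ∈ s, SlowSmooth k (F i)) : SlowSmooth k (fun x => ∑ i ∈ s, F i x) := by
  classical
  induction s using Finset.induction_on with
  | empty => simpa using slowSmooth_const 0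
  | insert a s ha ih =>
    simp_rw [Finset.sum_insert ha]
    exact (h a (by simp)).add (ih fun i hi => h i (by simp [hi]))

lemma laplacian_eq_sum_pd (hf : ContDiff ℝ 2 f) :
    (Δ f : RN N → ℝ) = fun x => ∑ i, pd i (pd i f) x := by
  rw [InnerProductSpace.laplacian_eq_iteratedFDeriv_orthonormalBasis f
    (EuclideanSpace.basisFun (Fin N) ℝ)]
  funext x
  refine Finset.sum_congr rfl fun i _ => ?_
  rw [iteratedFDeriv_two_apply]
  have hd : DifferentiableAt ℝ (fderiv ℝ f) x :=
    ((hf.fderiv_right (m := 1) (by norm_num)).differentiable (by norm_num)) x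
  have hpd : pd i (pd i f) x = fderiv ℝ (fun y => fderiv ℝ f y (EuclideanSpace.single i 1)) x
      (EuclideanSpace.single i 1) := rfl
  rw [hpd, fderiv_clm_apply hd (by fun_prop)]
  simp

lemma RapidSmooth.laplacian (hf : RapidSmooth (k + 2) f) : RapidSmooth k (Δ f) := by
  rw [laplacian_eq_sum_pd (hf.contDiff.of_le (by simp))]
  exact RapidSmooth.sum _ fun i _ => (SmoothClass.pd (SmoothClass.pd hf i) i)

lemma SlowSmooth.laplacian (hf : SlowSmooth (k + 2) f) : SlowSmooth k (Δ f) := by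
  rw [laplacian_eq_sum_pd (hf.contDiff.of_le (by simp))]
  exact SlowSmooth.sum _ fun i _ => (SmoothClass.pd (SmoothClass.pd hf i) i)

/-- A function of class `C^k` with compact support decays rapidly with its derivatives. -/
lemma rapidSmooth_of_hasCompactSupport (hf : ContDiff ℝ k f) (hc : HasCompactSupport f) :
    RapidSmooth k f := by
  have key : ∀ g : RN N → ℝ, Continuous g → HasCompactSupport g → IsRapid g := by
    intro g hg hgc p
    have hcont : Continuous fun x : RN N => g x * (1 + ‖x‖) ^ (-p) :=
      hg.mul ((by fun_prop : Continuous fun x : RN N => 1 + ‖x‖).rpow_const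
        fun x => Or.inl (one_add_norm_pos x).ne')
    obtain ⟨C, hC⟩ := hcont.bounded_above_of_compact_support hgc.mul_right
    refine ⟨C, fun x => ?_⟩
    have h1 := hC x
    rw [norm_mul, Real.norm_eq_abs, Real.norm_of_nonneg (by positivity),
      Real.rpow_neg (one_add_norm_pos x).le, ← div_eq_mul_inv,
      div_le_iff₀ (Real.rpow_pos_of_pos (one_add_norm_pos x) _)] at h1
    exact h1
  induction k generalizing f with
  | zero => exact ⟨hf.continuous, key f hf.continuous hc⟩
  | succ k ih =>
    refine ⟨⟨hf.differentiable (by simp), key f hf.continuous hc⟩, fun i => ih ?_ ?_⟩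
    · exact (hf.fderiv_right (m := k) (by simp)).clm_apply contDiff_const
    · exact hc.fderiv_apply (𝕜 := ℝ) _

/-- The exponential of a slowly growing smooth function, if it decays rapidly, decays rapidly
together with its derivatives. -/
lemma rapidSmooth_exp (hf : SlowSmooth k f) (h : IsRapid fun x => Real.exp (f x)) :
    RapidSmooth k fun x => Real.exp (f x) := by
  induction k with
  | zero => exact ⟨Real.continuous_exp.comp hf.continuous, h⟩
  | succ k ih =>
    refine ⟨⟨hf.differentiable.exp, h⟩, fun i => ?_⟩
    have : pd i (fun x => Real.exp (f x)) = fun x => Real.exp (f x) * pd i f x := by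
      funext x
      simp [pd, fderiv_exp (hf.differentiable x)]
    rw [this]
    exact (ih hf.of_succ).mul_slow (hf.2 i)

end classes

/-! ### Polynomials as slowly growing smooth functions -/

section polynomial

open MvPolynomial in
lemma differentiable_polyValue_and_pd (P : MvPolynomial (Fin N) ℝ) :
    Differentiable ℝ (polyValue P) ∧ ∀ i, pd i (polyValue P) = polyValue (pderiv i P) := by
  induction P using MvPolynomial.induction_on with
  | C a =>
    have h : polyValue (C a : MvPolynomial (Fin N) ℝ) = fun _ => a := by
      funext x; simp [polyValue]
    rw [h]
    refine ⟨differentiable_const _, fun i => ?_⟩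
    funext x
    simp [polyValue]
  | add p q hp hq =>
    have h : ∀ p q : MvPolynomial (Fin N) ℝ,
        polyValue (p + q) = fun x => polyValue p x + polyValue q x := by
      intro p q; funext x; simp [polyValue]
    rw [h]
    refine ⟨hp.1.add hq.1, fun i => ?_⟩
    rw [pd_add hp.1 hq.1, map_add, h, hp.2, hq.2]
  | mul_X p j hp =>
    have h : polyValue (p * X j) = fun x => polyValue p x * x j := by
      funext x; simp [polyValue]
    rw [h]
    refine ⟨hp.1.mul (differentiable_coord j), fun i => ?_⟩
    rw [pd_mul hp.1 (differentiable_coord j), pd_coord, hp.2]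
    funext x
    simp only [polyValue, Derivation.leibniz, pderiv_X, Pi.single_apply, smul_eq_mul, map_add,
      map_mul, eval_X, apply_ite (eval _), map_one, map_zero]
    ring

lemma isSlow_polyValue (P : MvPolynomial (Fin N) ℝ) : IsSlow (polyValue P) := by
  unfold polyValue
  induction P using MvPolynomial.induction_on with
  | C a => simpa using isSlow_const a
  | add p q hp hq => simpa using hp.add hq
  | mul_X p j hp => simpa using hp.mul (isSlow_coord j)

lemma slowSmooth_polyValue (k : ℕ) (P : MvPolynomial (Fin N) ℝ) : SlowSmooth k (polyValue P) := by
  induction k generalizing P with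
  | zero => exact ⟨(differentiable_polyValue_and_pd P).1.continuous, isSlow_polyValue P⟩
  | succ k ih =>
    refine ⟨⟨(differentiable_polyValue_and_pd P).1, isSlow_polyValue P⟩, fun i => ?_⟩
    rw [(differentiable_polyValue_and_pd P).2]
    exact ih _

lemma laplacian_polyValue (P : MvPolynomial (Fin N) ℝ) :
    (Δ (polyValue P) : RN N → ℝ) =
      polyValue (∑ i, MvPolynomial.pderiv i (MvPolynomial.pderiv i P)) := by
  rw [laplacian_eq_sum_pd (slowSmooth_polyValue 2 P).contDiff]
  funext x
  simp [(differentiable_polyValue_and_pd _).2, polyValue]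

end polynomial

/-! ### Linearity of the polyharmonic operator; polynomials in its kernel -/

section polyharmonic

variable {f g : RN N → ℝ} {m : ℕ}

@[simp] lemma polyharmonic_zero (f : RN N → ℝ) : polyharmonic 0 f = f := rfl

lemma polyharmonic_succ (m : ℕ) (f : RN N → ℝ) :
    polyharmonic (m + 1) f = polyharmonic m (fun x => -(Δ f) x) := rfl

lemma polyharmonic_succ' (m : ℕ) (f : RN N → ℝ) :
    polyharmonic (m + 1) f = fun x => -(Δ (polyharmonic m f)) x := by
  simp only [polyharmonic, Function.iterate_succ_apply']
  rfl

lemma SlowSmooth.neg_laplacian {k : ℕ} (hf : SlowSmooth (k + 2) f) :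
    SlowSmooth k (fun x => -(Δ f) x) := hf.laplacian.neg

lemma RapidSmooth.neg_laplacian {k : ℕ} (hf : RapidSmooth (k + 2) f) :
    RapidSmooth k (fun x => -(Δ f) x) := hf.laplacian.neg

lemma polyharmonic_add (hf : SlowSmooth (2 * m) f) (hg : SlowSmooth (2 * m) g) :
    polyharmonic m (fun x => f x + g x) = fun x => polyharmonic m f x + polyharmonic m g x := by
  induction m generalizing f g with
  | zero => rfl
  | succ m ih =>
    simp only [polyharmonic_succ]
    rw [← ih (SlowSmooth.neg_laplacian hf) (SlowSmooth.neg_laplacian hg)]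
    congr 1
    funext x
    have h := ((hf.of_le (l := 2) (by omega)).contDiff.contDiffAt (x := x)).laplacian_add
      ((hg.of_le (l := 2) (by omega)).contDiff.contDiffAt (x := x))
    have h2 : (fun x => f x + g x) = f + g := rfl
    rw [h2, h]
    ring

lemma polyharmonic_const_mul (c : ℝ) (hf : SlowSmooth (2 * m) f) :
    polyharmonic m (fun x => c * f x) = fun x => c * polyharmonic m f x := by
  induction m generalizing f with
  | zero => rfl
  | succ m ih =>
    simp only [polyharmonic_succ]
    rw [← ih (SlowSmooth.neg_laplacian hf)]
    congr 1
    funext x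
    have h := InnerProductSpace.laplacian_smul c
      ((hf.of_le (l := 2) (by omega)).contDiff.contDiffAt (x := x))
    have h2 : (fun x => c * f x) = c • f := rfl
    rw [h2, h, smul_eq_mul]
    ring

/-- Each Laplacian lowers degrees by two. Phrasing the degree bound through vanishing coefficients
lets the induction end at m = 0, where it forces P = 0. -/
lemma polyharmonic_polyValue_eq_zero (P : MvPolynomial (Fin N) ℝ)
    (hP : ∀ s : Fin N →₀ ℕ, 2 * m ≤ s.degree → P.coeff s = 0) :
    polyharmonic m (polyValue P) = fun _ => 0 := by
  induction m generalizing P with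
  | zero =>
    have : P = 0 := by ext s; simpa using hP s (by simp)
    funext x
    simp [this, polyValue]
  | succ m ih =>
    have h : (fun x => -(Δ (polyValue P)) x) =
        polyValue (-∑ i, MvPolynomial.pderiv i (MvPolynomial.pderiv i P)) := by
      rw [laplacian_polyValue]
      funext x
      simp [polyValue]
    rw [polyharmonic_succ, h]
    refine ih _ fun s hs => ?_
    rw [MvPolynomial.coeff_neg, MvPolynomial.coeff_sum, Finset.sum_eq_zero, neg_zero]
    intro i _
    rw [MvPolynomial.coeff_pderiv, MvPolynomial.coeff_pderiv, hP, zero_mul, zero_mul]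
    simp only [map_add, Finsupp.degree_single]
    omega

end polyharmonic

/-! ### Convolutions and transfer of derivatives -/

/-- The convolution `∫ k(z) f(x - z) dz`. -/
noncomputable def conv (k f : RN N → ℝ) (x : RN N) : ℝ := ∫ z, k z * f (x - z)

/-- Integrability of `k` against the weight `(1 + ‖z‖) ^ p`. -/
def WeightIntegrable (p : ℝ) (k : RN N → ℝ) : Prop :=
  Integrable fun z => k z * (1 + ‖z‖) ^ p

lemma continuous_weight (p : ℝ) : Continuous fun z : RN N => (1 + ‖z‖) ^ p :=
  (by fun_prop : Continuous fun x : RN N => 1 + ‖x‖).rpow_const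
    fun x => Or.inl (one_add_norm_pos x).ne'

lemma WeightIntegrable.aestronglyMeasurable {p : ℝ} {k : RN N → ℝ} (h : WeightIntegrable p k) :
    AEStronglyMeasurable k := by
  have h2 := (Integrable.aestronglyMeasurable h).mul (continuous_weight (N := N) (-p)).aestronglyMeasurable
  refine h2.congr (Eventually.of_forall fun z => ?_)
  simp only [Pi.mul_apply]
  rw [mul_assoc, ← Real.rpow_add (one_add_norm_pos z)]
  simp

/-- Peetre's inequality. For p ≥ 0 it follows from 1 + ‖x - z‖ ≤ (1 + ‖x‖)(1 + ‖z‖); for p ≤ 0 the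
same bound is applied to z = x - (x - z) and inverted. -/
lemma weight_sub_le (p : ℝ) (x z : RN N) :
    (1 + ‖x - z‖) ^ p ≤ (1 + ‖x‖) ^ |p| * (1 + ‖z‖) ^ p := by
  rcases le_total 0 p with hp | hp
  · rw [abs_of_nonneg hp, ← Real.mul_rpow (one_add_norm_pos x).le (one_add_norm_pos z).le]
    refine Real.rpow_le_rpow (one_add_norm_pos _).le ?_ hp
    nlinarith [norm_sub_le x z, norm_nonneg x, norm_nonneg z]
  · rw [abs_of_nonpos hp]
    have h1 : (1 + ‖z‖) ^ (-p) ≤ (1 + ‖x‖) ^ (-p) * (1 + ‖x - z‖) ^ (-p) := by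
      rw [← Real.mul_rpow (one_add_norm_pos x).le (one_add_norm_pos _).le]
      refine Real.rpow_le_rpow (one_add_norm_pos _).le ?_ (by linarith)
      have := norm_sub_le x (x - z)
      rw [sub_sub_cancel] at this
      nlinarith [norm_nonneg x, norm_nonneg (x - z)]
    have hz : (1 + ‖z‖) ^ p = ((1 + ‖z‖) ^ (-p))⁻¹ := by
      rw [Real.rpow_neg (one_add_norm_pos z).le, inv_inv]
    have hxz : (1 + ‖x - z‖) ^ p = ((1 + ‖x - z‖) ^ (-p))⁻¹ := by
      rw [Real.rpow_neg (one_add_norm_pos _).le, inv_inv]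
    rw [hz, hxz, ← div_eq_mul_inv, le_div_iff₀ (Real.rpow_pos_of_pos (one_add_norm_pos z) _),
      inv_mul_le_iff₀ (Real.rpow_pos_of_pos (one_add_norm_pos _) _)]
    linarith

section conv

variable {p : ℝ} {k f : RN N → ℝ}

/-- The majorant depends on x only through R, so it dominates on whole balls: this is what
continuity and differentiation under the integral need. -/
lemma HasGrowth.abs_mul_sub_le {C : ℝ} (hC : ∀ x, |f x| ≤ C * (1 + ‖x‖) ^ p) (hC0 : 0 ≤ C)
    {R : ℝ} (x z : RN N) (hx : ‖x‖ ≤ R) :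
    |k z * f (x - z)| ≤ C * (1 + R) ^ |p| * |k z * (1 + ‖z‖) ^ p| := by
  rw [abs_mul, abs_mul, abs_of_nonneg (Real.rpow_nonneg (one_add_norm_pos z).le p)]
  calc |k z| * |f (x - z)| ≤ |k z| * (C * ((1 + ‖x‖) ^ |p| * (1 + ‖z‖) ^ p)) := by
        gcongr
        exact (hC _).trans (mul_le_mul_of_nonneg_left (weight_sub_le p x z) hC0)
    _ ≤ |k z| * (C * ((1 + R) ^ |p| * (1 + ‖z‖) ^ p)) := by gcongr
    _ = _ := by ring

lemma WeightIntegrable.integrable_conv (hk : WeightIntegrable p k) (hf : Continuous f)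
    (hg : HasGrowth p f) (x : RN N) : Integrable fun z => k z * f (x - z) := by
  obtain ⟨C, hC0, hC⟩ := hg.exists_nonneg
  have hm : AEStronglyMeasurable fun z => k z * f (x - z) := hk.aestronglyMeasurable.mul
    (by fun_prop : Continuous fun z => f (x - z)).aestronglyMeasurable
  refine (hk.abs.const_mul (C * (1 + ‖x‖) ^ |p|)).mono' hm (Eventually.of_forall fun z => ?_)
  exact HasGrowth.abs_mul_sub_le hC hC0 x z le_rfl

lemma WeightIntegrable.hasGrowth_conv (hk : WeightIntegrable p k)
    (hg : HasGrowth p f) : HasGrowth |p| (conv k f) := by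
  obtain ⟨C, hC0, hC⟩ := hg.exists_nonneg
  refine ⟨C * ∫ z, |k z * (1 + ‖z‖) ^ p|, fun x => ?_⟩
  have h := norm_integral_le_of_norm_le (f := fun z => k z * f (x - z))
    (hk.abs.const_mul (C * (1 + ‖x‖) ^ |p|)) (Eventually.of_forall fun z =>
      HasGrowth.abs_mul_sub_le hC hC0 x z le_rfl)
  rw [integral_const_mul] at h
  refine h.trans (le_of_eq ?_)
  ring

lemma WeightIntegrable.continuous_conv (hk : WeightIntegrable p k) (hf : Continuous f)
    (hg : HasGrowth p f) : Continuous (conv k f) := by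
  obtain ⟨C, hC0, hC⟩ := hg.exists_nonneg
  rw [continuous_iff_continuousAt]
  intro x₀
  refine continuousAt_of_dominated
    (bound := fun z => C * (1 + (‖x₀‖ + 1)) ^ |p| * |k z * (1 + ‖z‖) ^ p|)
    (Eventually.of_forall fun x => (hk.integrable_conv hf hg x).aestronglyMeasurable) ?_
    (hk.abs.const_mul _) (Eventually.of_forall fun z => by fun_prop)
  filter_upwards [Metric.ball_mem_nhds x₀ one_pos] with x hx
  refine Eventually.of_forall fun z => HasGrowth.abs_mul_sub_le hC hC0 x z ?_
  have := norm_le_norm_add_norm_sub' x x₀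
  rw [mem_ball_iff_norm] at hx
  linarith

lemma WeightIntegrable.differentiable_conv (hk : WeightIntegrable p k) (hf : Differentiable ℝ f)
    (hg : HasGrowth p f) (hfc : ∀ i, Continuous (pd i f)) (hfg : ∀ i, HasGrowth p (pd i f)) :
    Differentiable ℝ (conv k f) ∧ ∀ i, pd i (conv k f) = conv k (pd i f) := by
  choose C hC0 hC using fun i => (hfg i).exists_nonneg
  have hcont : Continuous (fderiv ℝ f) := by
    rw [continuous_clm_apply]
    intro y
    simp_rw [fderiv_apply_eq_sum_pd]
    fun_prop
  have hmeas : ∀ x, AEStronglyMeasurable (fun z => k z • fderiv ℝ f (x - z)) :=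
    fun x => hk.aestronglyMeasurable.smul
      (by fun_prop : Continuous fun z => fderiv ℝ f (x - z)).aestronglyMeasurable
  have hbound : ∀ R : ℝ, ∀ x z : RN N, ‖x‖ ≤ R → ‖k z • fderiv ℝ f (x - z)‖ ≤
      (∑ i, C i) * (1 + R) ^ |p| * |k z * (1 + ‖z‖) ^ p| := by
    intro R x z hx
    rw [norm_smul, Real.norm_eq_abs]
    calc |k z| * ‖fderiv ℝ f (x - z)‖ ≤ |k z| * ∑ i, |pd i f (x - z)| := by
          gcongr
          exact norm_fderiv_le_sum_pd _
      _ = ∑ i, |k z * pd i f (x - z)| := by simp_rw [Finset.mul_sum, abs_mul]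
      _ ≤ ∑ i, C i * (1 + R) ^ |p| * |k z * (1 + ‖z‖) ^ p| :=
          Finset.sum_le_sum fun i _ => HasGrowth.abs_mul_sub_le (hC i) (hC0 i) x z hx
      _ = _ := by rw [Finset.sum_mul, Finset.sum_mul]
  have hder : ∀ x₀, HasFDerivAt (conv k f) (∫ z, k z • fderiv ℝ f (x₀ - z)) x₀ := by
    intro x₀
    refine hasFDerivAt_integral_of_dominated_of_fderiv_le (𝕜 := ℝ)
      (bound := fun z => (∑ i, C i) * (1 + (‖x₀‖ + 1)) ^ |p| * |k z * (1 + ‖z‖) ^ p|)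
      (F' := fun x z => k z • fderiv ℝ f (x - z))
      (Metric.ball_mem_nhds x₀ one_pos)
      (Eventually.of_forall fun x => (hk.integrable_conv hf.continuous hg x).aestronglyMeasurable)
      (hk.integrable_conv hf.continuous hg x₀) (hmeas x₀) ?_ (hk.abs.const_mul _) ?_
    · refine Eventually.of_forall fun z x hx => hbound _ x z ?_
      have := norm_le_norm_add_norm_sub' x x₀
      rw [mem_ball_iff_norm] at hx
      linarith
    · refine Eventually.of_forall fun z x _ => ?_
      have h1 : HasFDerivAt (fun x => f (x - z)) (fderiv ℝ f (x - z)) x := by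
        exact (hasFDerivAt_comp_sub z).2 (hf (x - z)).hasFDerivAt
      exact h1.const_mul (k z)
  refine ⟨fun x => (hder x).differentiableAt, fun i => ?_⟩
  funext x
  have hint : Integrable fun z => k z • fderiv ℝ f (x - z) :=
    (hk.abs.const_mul _).mono' (hmeas x)
      (Eventually.of_forall fun z => hbound ‖x‖ x z le_rfl)
  simp only [pd, conv]
  rw [(hder x).fderiv, ContinuousLinearMap.integral_apply hint]
  rfl

lemma IsRapid.weightIntegrable (hf : IsRapid f) (hc : Continuous f) (p : ℝ) :
    WeightIntegrable p f := by
  obtain ⟨C, hC⟩ := hf (-(N + 1) - p)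
  refine ((integrable_one_add_norm (E := RN N) (μ := volume) (r := N + 1)
    (by simp)).const_mul C).mono' (hc.mul (continuous_weight p)).aestronglyMeasurable
    (Eventually.of_forall fun z => ?_)
  rw [norm_mul, Real.norm_of_nonneg (Real.rpow_nonneg (one_add_norm_pos z).le p)]
  have h1 := mul_le_mul_of_nonneg_right (hC z) (Real.rpow_nonneg (one_add_norm_pos z).le p)
  rw [mul_assoc, ← Real.rpow_add (one_add_norm_pos z)] at h1
  simpa using h1

lemma IsRapid.integrable (hf : IsRapid f) (hc : Continuous f) : Integrable f := by
  simpa [WeightIntegrable] using hf.weightIntegrable hc 0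

lemma IsSlow.weightIntegrable (hf : IsSlow f) (hc : Continuous f) :
    ∃ p, WeightIntegrable p f := by
  obtain ⟨r, C, hC⟩ := hf
  refine ⟨-(N + 1) - r, ?_⟩
  refine ((integrable_one_add_norm (E := RN N) (μ := volume) (r := N + 1)
    (by simp)).const_mul C).mono' (hc.mul (continuous_weight _)).aestronglyMeasurable
    (Eventually.of_forall fun z => ?_)
  rw [norm_mul, Real.norm_of_nonneg (Real.rpow_nonneg (one_add_norm_pos z).le _)]
  have h1 := mul_le_mul_of_nonneg_right (hC z)
    (Real.rpow_nonneg (one_add_norm_pos z).le (-(N + 1) - r))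
  rw [mul_assoc, ← Real.rpow_add (one_add_norm_pos z)] at h1
  simpa using h1

lemma conv_comm (k f : RN N → ℝ) : conv k f = conv f k := by
  funext x
  simp only [conv]
  rw [← integral_sub_left_eq_self _ volume x]
  simp [mul_comm]

lemma WeightIntegrable.slowSmooth_conv {n : ℕ} (hk : WeightIntegrable p k)
    (hf : RapidSmooth n f) : SlowSmooth n (conv k f) := by
  induction n generalizing f with
  | zero => exact ⟨hk.continuous_conv hf.1 (hf.2 p), |p|, hk.hasGrowth_conv (hf.2 p)⟩
  | succ n ih =>
    have h := hk.differentiable_conv hf.differentiable (hf.prop p)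
      (fun i => (hf.2 i).continuous) fun i => (hf.2 i).prop p
    refine ⟨⟨h.1, |p|, hk.hasGrowth_conv (hf.prop p)⟩, fun i => ?_⟩
    rw [h.2]
    exact ih (hf.2 i)

lemma WeightIntegrable.pd_conv (hk : WeightIntegrable p k)
    (hf : RapidSmooth 1 f) (i : Fin N) : pd i (conv k f) = conv k (pd i f) :=
  (hk.differentiable_conv hf.differentiable (hf.prop p)
      (fun i => (hf.2 i).continuous) fun i => (hf.2 i).prop p).2 i

/-- Here the derivative falls on the slow factor: after `conv_comm` the rapid factor plays the role
of the kernel, integrable against every weight. -/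
lemma pd_conv_slow {g : RN N → ℝ} (hg : SlowSmooth 1 g) (hf : RapidSmooth 0 f) :
    Differentiable ℝ (conv g f) ∧ ∀ i, pd i (conv g f) = conv (pd i g) f := by
  -- One exponent that works for g and all its first derivatives.
  obtain ⟨p, hp⟩ : ∃ p, HasGrowth p g ∧ ∀ i, HasGrowth p (pd i g) := by
    obtain ⟨p₀, hp₀⟩ := hg.prop
    choose p hp using fun i => (hg.2 i).2
    refine ⟨|p₀| + ∑ i, |p i|, hp₀.mono ?_, fun i => (hp i).mono ?_⟩
    · have : 0 ≤ ∑ i, |p i| := Finset.sum_nonneg fun i _ => abs_nonneg _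
      linarith [le_abs_self p₀]
    · have := Finset.single_le_sum (f := fun i => |p i|) (fun i _ => abs_nonneg _)
        (Finset.mem_univ i)
      linarith [le_abs_self (p i), abs_nonneg p₀]
  have h := (hf.2.weightIntegrable hf.1 p).differentiable_conv hg.differentiable hp.1
    (fun i => (hg.2 i).continuous) hp.2
  rw [conv_comm g f]
  exact ⟨h.1, fun i => by rw [h.2, conv_comm]⟩

lemma conv_sum {ι : Type*} (s : Finset ι) (hk : WeightIntegrable p k) {F : ι → RN N → ℝ}
    (hF : ∀ i ∈ s, RapidSmooth 0 (F i)) :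
    conv k (fun x => ∑ i ∈ s, F i x) = fun x => ∑ i ∈ s, conv k (F i) x := by
  funext x
  simp only [conv, Finset.mul_sum]
  exact integral_finsetSum _ fun i hi =>
    hk.integrable_conv (hF i hi).1 ((hF i hi).2 p) x

lemma conv_neg (k f : RN N → ℝ) : conv k (fun x => - f x) = fun x => - conv k f x := by
  funext x
  simp [conv, integral_neg]

lemma WeightIntegrable.neg_laplacian_conv (hk : WeightIntegrable p k) (hf : RapidSmooth 2 f) :
    (fun x => -(Δ (conv k f)) x) = conv k (fun x => -(Δ f) x) := by
  rw [conv_neg, laplacian_eq_sum_pd (hk.slowSmooth_conv hf).contDiff,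
    laplacian_eq_sum_pd hf.contDiff, conv_sum _ hk fun i _ => (hf.2 i).2 i]
  simp_rw [hk.pd_conv hf.of_succ, hk.pd_conv (hf.2 _)]

lemma WeightIntegrable.polyharmonic_conv {m : ℕ} (hk : WeightIntegrable p k)
    (hf : RapidSmooth (2 * m) f) : polyharmonic m (conv k f) = conv k (polyharmonic m f) := by
  induction m generalizing f with
  | zero => rfl
  | succ m ih =>
    rw [polyharmonic_succ, polyharmonic_succ, hk.neg_laplacian_conv (hf.of_le (by omega)),
      ih (RapidSmooth.neg_laplacian hf)]

/-- Integration by parts without boundary terms: both sides equal -Δ(g * f), with the derivatives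
placed on one factor or on the other. -/
lemma conv_neg_laplacian {g : RN N → ℝ} (hg : SlowSmooth 2 g) (hf : RapidSmooth 2 f) :
    conv g (fun x => -(Δ f) x) = conv (fun x => -(Δ g) x) f := by
  obtain ⟨p, hp⟩ := hg.prop.weightIntegrable hg.continuous
  have h3 : conv (fun x => -(Δ g) x) f = fun x => -conv (Δ g) f x := by
    rw [conv_comm _ f, conv_neg, conv_comm f]
  rw [← hp.neg_laplacian_conv hf, h3,
    laplacian_eq_sum_pd (hp.slowSmooth_conv hf).contDiff, laplacian_eq_sum_pd hg.contDiff]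
  funext x
  congr 1
  have h : ∀ i, pd i (pd i (conv g f)) = conv (pd i (pd i g)) f := fun i => by
    rw [(pd_conv_slow hg.of_succ hf.of_succ.of_succ).2, (pd_conv_slow (hg.2 i) hf.of_succ.of_succ).2]
  simp_rw [h, conv, Finset.sum_mul]
  rw [integral_finsetSum]
  intro i _
  obtain ⟨r, hr⟩ := ((hg.2 i).2 i).2.weightIntegrable ((hg.2 i).2 i).1
  exact hr.integrable_conv hf.continuous (hf.prop r) x

lemma RapidSmooth.polyharmonic {n m : ℕ} (hf : RapidSmooth (n + 2 * m) f) :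
    RapidSmooth n (polyharmonic m f) := by
  induction m generalizing f with
  | zero => exact hf
  | succ m ih => exact ih (RapidSmooth.neg_laplacian hf)

lemma conv_polyharmonic {g : RN N → ℝ} {m : ℕ} (hg : SlowSmooth (2 * m) g)
    (hf : RapidSmooth (2 * m) f) : conv g (polyharmonic m f) = conv (polyharmonic m g) f := by
  induction m generalizing f g with
  | zero => rfl
  | succ m ih =>
    rw [polyharmonic_succ' m f, conv_neg_laplacian (hg.of_le (by omega))
      (RapidSmooth.polyharmonic (n := 2) (by convert hf using 1; ring)),
      ih (SlowSmooth.neg_laplacian hg) (hf.of_le (by omega)), polyharmonic_succ]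

end conv

lemma neg_laplacian_sum {ι : Type*} (t : Finset ι) (c : ι → ℝ) {F : ι → RN N → ℝ}
    (h : ∀ i, SlowSmooth 2 (F i)) :
    (fun x => -(Δ (fun y => ∑ i ∈ t, c i * F i y)) x) =
      fun x => ∑ i ∈ t, c i * -(Δ (F i)) x := by
  classical
  have key : polyharmonic 1 (fun y => ∑ i ∈ t, c i * F i y) =
      fun x => ∑ i ∈ t, c i * polyharmonic 1 (F i) x := by
    induction t using Finset.induction_on with
    | empty =>
      simpa using polyharmonic_const_mul (m := 1) 0 (slowSmooth_const (N := N) (k := 2) 0)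
    | insert a t ha ih =>
      simp_rw [Finset.sum_insert ha]
      rw [polyharmonic_add (m := 1) ((h a).const_mul _)
        (SlowSmooth.sum _ fun i _ => (h i).const_mul _), ih,
        polyharmonic_const_mul (m := 1) _ (h a)]
  exact key

/-! ### Powers of |x|² + τ under the polyharmonic operator -/

/-- The function `(|x|² + τ)^{-s}`. -/
noncomputable def bubble (τ s : ℝ) (x : RN N) : ℝ := (‖x‖ ^ 2 + τ) ^ (-s)

section bubble

variable {τ s : ℝ}

lemma normSq_add_pos (hτ : 0 < τ) (x : RN N) : 0 < ‖x‖ ^ 2 + τ := by positivity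

lemma bubble_pos (hτ : 0 < τ) (s : ℝ) (x : RN N) : 0 < bubble τ s x :=
  Real.rpow_pos_of_pos (normSq_add_pos hτ x) _

lemma normSq_mul_bubble (hτ : 0 < τ) (s : ℝ) (x : RN N) :
    ‖x‖ ^ 2 * bubble τ (s + 1) x = bubble τ s x - τ * bubble τ (s + 1) x := by
  have h : bubble τ s x = bubble τ (s + 1) x * (‖x‖ ^ 2 + τ) := by
    simp only [bubble]
    nth_rewrite 3 [← Real.rpow_one (‖x‖ ^ 2 + τ)]
    rw [← Real.rpow_add (normSq_add_pos hτ x)]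
    congr 1
    ring
  rw [h]
  ring

lemma hasFDerivAt_bubble (hτ : 0 < τ) (s : ℝ) (x : RN N) :
    HasFDerivAt (bubble τ s) ((-2 * s * bubble τ (s + 1) x) • innerSL ℝ x) x := by
  have h1 : HasFDerivAt (fun y : RN N => ‖y‖ ^ 2 + τ) (2 • innerSL ℝ x) x :=
    (hasStrictFDerivAt_norm_sq x).hasFDerivAt.add_const τ
  have h2 := h1.rpow_const (p := -s) (Or.inl (normSq_add_pos hτ x).ne')
  refine h2.congr_fderiv ?_
  ext y
  simp only [bubble, _root_.smul_apply, smul_eq_mul, nsmul_eq_mul]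
  rw [show -s - 1 = -(s + 1) by ring]
  push_cast
  ring

lemma differentiable_bubble (hτ : 0 < τ) (s : ℝ) : Differentiable ℝ (bubble (N := N) τ s) :=
  fun x => (hasFDerivAt_bubble hτ s x).differentiableAt

lemma pd_bubble (hτ : 0 < τ) (s : ℝ) (i : Fin N) :
    pd i (bubble τ s) = fun x => -2 * s * (x i * bubble τ (s + 1) x) := by
  funext x
  simp only [pd, (hasFDerivAt_bubble hτ s x).fderiv, _root_.smul_apply,
    innerSL_apply_apply, EuclideanSpace.inner_single_right, smul_eq_mul]
  simp
  ring

lemma slowSmooth_bubble (hτ : 0 < τ) (hs : 0 ≤ s) (k : ℕ) :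
    SlowSmooth k (bubble (N := N) τ s) := by
  have hslow : ∀ s : ℝ, 0 ≤ s → IsSlow (bubble (N := N) τ s) := by
    intro s hs
    refine ⟨0, τ ^ (-s), fun x => ?_⟩
    rw [abs_of_pos (bubble_pos hτ s x), Real.rpow_zero, mul_one]
    exact Real.rpow_le_rpow_of_nonpos hτ (by nlinarith [sq_nonneg ‖x‖]) (by linarith)
  induction k generalizing s with
  | zero => exact ⟨(differentiable_bubble hτ s).continuous, hslow s hs⟩
  | succ k ih =>
    refine ⟨⟨differentiable_bubble hτ s, hslow s hs⟩, fun i => ?_⟩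
    rw [pd_bubble hτ]
    exact ((slowSmooth_coord i).mul (ih (by linarith))).const_mul _

/-- The factor |x|² arising from second derivatives is traded for a shift of the exponent by
`normSq_mul_bubble`, so the span of these powers is preserved. Both coefficients are nonnegative
when s + 1 ≤ N/2, which is used for the Rellich inequality. -/
lemma neg_laplacian_bubble (hτ : 0 < τ) (hs : 0 ≤ s) :
    (fun x => -(Δ (bubble (N := N) τ s)) x) = fun x =>
      4 * s * (N / 2 - s - 1) * bubble τ (s + 1) x +
        4 * s * (s + 1) * τ * bubble τ (s + 2) x := by
  rw [laplacian_eq_sum_pd (slowSmooth_bubble hτ hs 2).contDiff]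
  funext x
  have h : ∀ i : Fin N, pd i (pd i (bubble τ s)) x =
      -2 * s * bubble τ (s + 1) x + 4 * s * (s + 1) * bubble τ (s + 2) x * x i ^ 2 := by
    intro i
    rw [pd_bubble hτ, pd_const_mul (f := fun x : RN N => x i * bubble τ (s + 1) x)
      ((differentiable_coord i).mul (differentiable_bubble hτ _)),
      pd_mul (differentiable_coord i) (differentiable_bubble hτ _), pd_bubble hτ, pd_coord]
    simp only [if_true]
    rw [show s + 1 + 1 = s + 2 by ring]
    ring
  simp_rw [h]
  rw [Finset.sum_add_distrib, ← Finset.mul_sum (s := Finset.univ) (f := fun i => x i ^ 2), ← EuclideanSpace.real_norm_sq_eq]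
  have h2 := normSq_mul_bubble hτ (s + 1) x
  rw [show s + 1 + 1 = s + 2 by ring] at h2
  have h3 : 4 * s * (s + 1) * bubble τ (s + 2) x * ‖x‖ ^ 2 =
    4 * s * (s + 1) * (bubble τ (s + 1) x - τ * bubble τ (s + 2) x) := by rw [← h2]; ring
  rw [h3]
  simp
  ring

/-- The coefficients in the expansion of `(-Δ)^j (|x|² + τ)^{-s}` for `s = N / 2 - m`. -/
noncomputable def bubbleCoeff (m : ℕ) (s : ℝ) (j i : ℕ) : ℝ :=
  4 ^ j * j.choose i * (∏ l ∈ Finset.range (j + i), (s + l)) *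
    ∏ l ∈ Finset.range (j - i), ((m : ℝ) - j + l)

lemma bubbleCoeff_succ_zero (m : ℕ) (s : ℝ) (j : ℕ) :
    bubbleCoeff m s (j + 1) 0 = 4 * (s + j) * (m - j - 1) * bubbleCoeff m s j 0 := by
  simp only [bubbleCoeff, Nat.choose_zero_right, add_zero, Nat.sub_zero]
  rw [Finset.prod_range_succ, Finset.prod_range_succ' (fun l : ℕ => (m : ℝ) - (j + 1 : ℕ) + l)]
  have : ∀ l : ℕ, (m : ℝ) - (j + 1 : ℕ) + (l + 1 : ℕ) = m - j + l := by
    intro l; push_cast; ring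
  simp_rw [this]
  push_cast
  ring

/-- The recurrence produced by one more application of -Δ. After the common products are factored
out it reduces to (i + 1) C(j, i + 1) = (j - i) C(j, i). -/
lemma bubbleCoeff_succ_succ (m : ℕ) (s : ℝ) {j i : ℕ} (hij : i ≤ j) :
    bubbleCoeff m s (j + 1) (i + 1) =
      4 * (s + j + (i + 1)) * (m - j - (i + 1) - 1) * bubbleCoeff m s j (i + 1) +
      4 * (s + j + i) * (s + j + i + 1) * bubbleCoeff m s j i := by
  have hA : ∏ l ∈ Finset.range (j + 1 + (i + 1)), (s + (l : ℝ)) =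
      (∏ l ∈ Finset.range (j + i), (s + (l : ℝ))) * (s + j + i) * (s + j + i + 1) := by
    rw [show j + 1 + (i + 1) = j + i + 1 + 1 by ring, Finset.prod_range_succ,
      Finset.prod_range_succ]
    push_cast
    ring
  have hA' : ∏ l ∈ Finset.range (j + (i + 1)), (s + (l : ℝ)) =
      (∏ l ∈ Finset.range (j + i), (s + (l : ℝ))) * (s + j + i) := by
    rw [show j + (i + 1) = j + i + 1 by ring, Finset.prod_range_succ]
    push_cast
    ring
  simp only [bubbleCoeff, hA, hA']
  rcases hij.eq_or_lt with rfl | hlt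
  · simp
    ring
  · obtain ⟨n, rfl⟩ : ∃ n, j = i + 1 + n := ⟨j - (i + 1), by omega⟩
    have hch : (((i + 1 + n).choose (i + 1) : ℕ) : ℝ) * (i + 1) =
        ((i + 1 + n).choose i : ℕ) * (n + 1) := by
      have := Nat.choose_succ_right_eq (i + 1 + n) i
      rw [show i + 1 + n - i = n + 1 by omega] at this
      exact_mod_cast this
    rw [show i + 1 + n + 1 - (i + 1) = n + 1 by omega, show i + 1 + n - (i + 1) = n by omega,
      show i + 1 + n - i = n + 1 by omega, Nat.choose_succ_succ',
      Finset.prod_range_succ' (fun l : ℕ => (m : ℝ) - ((i + 1 + n + 1 : ℕ) : ℝ) + l),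
      Finset.prod_range_succ (fun l : ℕ => (m : ℝ) - ((i + 1 + n : ℕ) : ℝ) + l)]
    have : ∀ l : ℕ, (m : ℝ) - (i + 1 + n + 1 : ℕ) + (l + 1 : ℕ) = m - (i + 1 + n : ℕ) + l := by
      intro l; push_cast; ring
    simp_rw [this]
    push_cast
    generalize (∏ l ∈ Finset.range n, ((m : ℝ) - (i + 1 + n) + l)) = X
    generalize (∏ l ∈ Finset.range (i + 1 + n + i), (s + (l : ℝ))) = A
    linear_combination (4 : ℝ) ^ (i + 1 + n) * 4 * A * X * (s + (i + 1 + n) + i) *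
      (s + (i + 1 + n) + i + 1) * hch

/-- At j = m the factor l = 0 of the second product is m - j = 0. Only i = m, where that product is
empty, survives. -/
lemma bubbleCoeff_diag (m : ℕ) (s : ℝ) (i : ℕ) (hi : i < m) : bubbleCoeff m s m i = 0 := by
  rw [bubbleCoeff, Finset.prod_eq_zero (s := Finset.range (m - i)) (i := 0)
    (by simpa using Nat.sub_pos_of_lt hi) (by simp), mul_zero]

lemma polyharmonic_bubble_expansion {m : ℕ} (hτ : 0 < τ) (hs : 0 ≤ s)
    (hN : (N : ℝ) = 2 * (s + m)) (j : ℕ) :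
    polyharmonic j (bubble (N := N) τ s) = fun x => ∑ i ∈ Finset.range (j + 1),
      (bubbleCoeff m s j i * τ ^ i) * bubble τ (s + j + i) x := by
  induction j with
  | zero => funext x; simp [bubbleCoeff]
  | succ j ih =>
    rw [polyharmonic_succ', ih, neg_laplacian_sum _ _
      fun i => slowSmooth_bubble hτ (by positivity) 2]
    funext x
    have hb : ∀ i : ℕ, -(Δ (bubble (N := N) τ (s + j + i))) x =
        4 * (s + j + i) * (m - j - i - 1) * bubble τ (s + j + 1 + i) x +
          4 * (s + j + i) * (s + j + i + 1) * τ * bubble τ (s + j + 1 + (i + 1 : ℕ)) x := by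
      intro i
      have := congrFun (neg_laplacian_bubble (N := N) (s := s + j + i) hτ (by positivity)) x
      rw [this, hN, show s + j + i + 1 = s + j + 1 + i by ring,
        show s + j + 1 + ((i + 1 : ℕ) : ℝ) = s + j + i + 2 by push_cast; ring]
      ring
    simp_rw [hb]
    simp only [mul_add (bubbleCoeff m s j _ * τ ^ _), Finset.sum_add_distrib]
    -- A vanishing extra term i = j + 1 gives the unshifted sum the same range as the shifted one.
    have hzero : bubbleCoeff m s j (j + 1) = 0 := by simp [bubbleCoeff]
    have h1 : ∑ i ∈ Finset.range (j + 1), bubbleCoeff m s j i * τ ^ i *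
          (4 * (s + j + i) * (m - j - i - 1) * bubble τ (s + j + 1 + i) x) =
        ∑ i ∈ Finset.range (j + 1 + 1), bubbleCoeff m s j i * τ ^ i *
          (4 * (s + j + i) * (m - j - i - 1) * bubble τ (s + j + 1 + i) x) := by
      rw [Finset.sum_range_succ _ (j + 1), hzero]
      ring
    rw [h1, Finset.sum_range_succ', Finset.sum_range_succ' _ (j + 1), bubbleCoeff_succ_zero,
      add_right_comm, ← Finset.sum_add_distrib]
    congr 1
    · refine Finset.sum_congr rfl fun i hi => ?_
      rw [bubbleCoeff_succ_succ m s (by simpa [Nat.lt_succ_iff] using hi)]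
      push_cast
      rw [show s + ((j : ℝ) + 1) + (i + 1) = s + j + 1 + (i + 1) by ring]
      ring
    · push_cast
      rw [show s + ((j : ℝ) + 1) + 0 = s + j + 1 + 0 by ring]
      ring

/-- The constant in `(-Δ)^m (|x|² + τ)^{-s} = c τ^m (|x|² + τ)^{-s - 2m}`. -/
noncomputable def bubbleConst (m : ℕ) (s : ℝ) : ℝ :=
  4 ^ m * ∏ l ∈ Finset.range (2 * m), (s + l)

lemma bubbleConst_pos (m : ℕ) (hs : 0 < s) : 0 < bubbleConst m s :=
  mul_pos (by positivity) (Finset.prod_pos fun l _ => by positivity)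

lemma polyharmonic_bubble {m : ℕ} (hτ : 0 < τ) (hs : 0 ≤ s) (hN : (N : ℝ) = 2 * (s + m)) :
    polyharmonic m (bubble (N := N) τ s) = fun x =>
      bubbleConst m s * τ ^ m * bubble τ (s + 2 * m) x := by
  rw [polyharmonic_bubble_expansion hτ hs hN]
  funext x
  rw [Finset.sum_range_succ, Finset.sum_eq_zero, zero_add]
  · simp only [bubbleCoeff, bubbleConst, Nat.choose_self, Nat.sub_self, Finset.prod_range_zero,
      Nat.cast_one, mul_one, two_mul]
    rw [add_assoc]
  · intro i hi
    rw [bubbleCoeff_diag m s i (by simpa using hi)]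
    ring

end bubble

/-! ### The Riesz kernel as fundamental solution -/

section kernel

variable {τ s : ℝ} {f : RN N → ℝ}

lemma bubble_zero_nonneg (s : ℝ) (x : RN N) : 0 ≤ bubble 0 s x :=
  Real.rpow_nonneg (by positivity) _

lemma bubble_zero_eq (s : ℝ) (x : RN N) : bubble 0 s x = ‖x‖ ^ (-(2 * s)) := by
  simp only [bubble, add_zero]
  rw [← Real.rpow_natCast, ← Real.rpow_mul (norm_nonneg x)]
  congr 1
  push_cast
  ring

lemma bubble_le_bubble_zero (hτ : 0 ≤ τ) (hs : 0 ≤ s) {x : RN N} (hx : x ≠ 0) :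
    bubble τ s x ≤ bubble 0 s x := by
  have : 0 < ‖x‖ := norm_pos_iff.2 hx
  exact Real.rpow_le_rpow_of_nonpos (by positivity) (by linarith) (by linarith)

lemma tendsto_bubble_zero (s : ℝ) {x : RN N} (hx : x ≠ 0) :
    Tendsto (fun τ => bubble τ s x) (𝓝[>] 0) (𝓝 (bubble 0 s x)) := by
  have : 0 < ‖x‖ := norm_pos_iff.2 hx
  have hc : ContinuousAt (fun τ : ℝ => bubble τ s x) 0 :=
    ContinuousAt.rpow_const (by fun_prop) (Or.inl (by positivity))
  exact hc.tendsto.mono_left nhdsWithin_le_nhds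

lemma measurable_bubble (τ s : ℝ) : Measurable (bubble (N := N) τ s) := by
  unfold bubble
  fun_prop

lemma ae_ne_zero (hN : 0 < N) : ∀ᵐ x : RN N, x ≠ 0 := by
  have : Nonempty (Fin N) := ⟨⟨0, hN⟩⟩
  have := Measure.ae_ne (volume : Measure (RN N)) 0
  exact this

/-- The singularity is integrable on the unit ball because 2s < N; outside, the kernel is at most 1
and the weight is integrable. -/
lemma weightIntegrable_bubble_zero (hs : 0 ≤ s) (hN : 2 * s < N) :
    WeightIntegrable (-(N + 1)) (bubble (N := N) 0 s) := by
  have hN0 : 0 < N := by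
    have : (0 : ℝ) < N := by linarith
    exact_mod_cast this
  have h1 : IntegrableOn (bubble (N := N) 0 s) (Metric.ball 0 1) :=
    integrableOn_ball_of_norm_le_rpow (C := 1) (α := 2 * s) (by rw [finrank_euclideanSpace_fin]; exact hN0)
      (by simpa using hN)
      (Eventually.of_forall fun x => by
        rw [Real.norm_of_nonneg (bubble_zero_nonneg s x), bubble_zero_eq, one_mul])
      (measurable_bubble 0 s).aestronglyMeasurable
  have h2 : Integrable fun z : RN N => (1 + ‖z‖) ^ (-((N : ℝ) + 1)) :=
    integrable_one_add_norm (by simp)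
  rw [← integrable_indicator_iff Metric.isOpen_ball.measurableSet] at h1
  refine (h1.add h2).mono' ((measurable_bubble 0 s).aestronglyMeasurable.mul
    (continuous_weight _).aestronglyMeasurable) (Eventually.of_forall fun z => ?_)
  have hw : 0 ≤ (1 + ‖z‖) ^ (-((N : ℝ) + 1)) := Real.rpow_nonneg (one_add_norm_pos z).le _
  have hw1 : (1 + ‖z‖) ^ (-((N : ℝ) + 1)) ≤ 1 :=
    Real.rpow_le_one_of_one_le_of_nonpos (one_le_one_add_norm z) (by linarith)
  have hb := bubble_zero_nonneg s z
  rw [Real.norm_of_nonneg (mul_nonneg hb hw), Pi.add_apply]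
  by_cases hz : z ∈ Metric.ball (0 : RN N) 1
  · rw [Set.indicator_of_mem hz]
    nlinarith
  · rw [Set.indicator_of_notMem hz, zero_add]
    have hz1 : 1 ≤ ‖z‖ := by simpa using hz
    have : bubble 0 s z ≤ 1 := by
      rw [bubble_zero_eq]
      exact Real.rpow_le_one_of_one_le_of_nonpos hz1 (by linarith)
    nlinarith

/-- Convolution with regularised kernels converges. -/
lemma tendsto_conv_of_dominated {ι : Type*} {l : Filter ι} [l.IsCountablyGenerated] {p : ℝ}
    {kr : ι → RN N → ℝ} {k b : RN N → ℝ} (hb : WeightIntegrable p b)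
    (hm : ∀ᶠ t in l, AEStronglyMeasurable (kr t))
    (hle : ∀ᶠ t in l, ∀ᵐ z, |kr t z| ≤ |b z|)
    (hlim : ∀ᵐ z, Tendsto (fun t => kr t z) l (𝓝 (k z)))
    (hf : Continuous f) (hg : HasGrowth p f) (x : RN N) :
    Tendsto (fun t => conv (kr t) f x) l (𝓝 (conv k f x)) := by
  refine tendsto_integral_filter_of_dominated_convergence (fun z => |b z * f (x - z)|) ?_ ?_
    (hb.integrable_conv hf hg x).abs ?_
  · filter_upwards [hm] with t ht
    exact ht.mul (by fun_prop : Continuous fun z => f (x - z)).aestronglyMeasurable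
  · filter_upwards [hle] with t ht
    filter_upwards [ht] with z hz
    rw [norm_mul, abs_mul, Real.norm_eq_abs, Real.norm_eq_abs]
    gcongr
  · filter_upwards [hlim] with z hz
    exact hz.mul_const _

lemma abs_conv_le_of_dominated {p C : ℝ} {k b : RN N → ℝ} (hb : WeightIntegrable p b)
    (hle : ∀ᵐ z, |k z| ≤ |b z|) (hC0 : 0 ≤ C) (hC : ∀ x, |f x| ≤ C * (1 + ‖x‖) ^ p) (x : RN N) :
    |conv k f x| ≤ C * (∫ z, |b z * (1 + ‖z‖) ^ p|) * (1 + ‖x‖) ^ |p| := by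
  have h := norm_integral_le_of_norm_le (f := fun z => k z * f (x - z))
    (hb.abs.const_mul (C * (1 + ‖x‖) ^ |p|)) (by
      filter_upwards [hle] with z hz
      refine le_trans ?_ (HasGrowth.abs_mul_sub_le hC hC0 x z le_rfl)
      rw [norm_mul, abs_mul, Real.norm_eq_abs, Real.norm_eq_abs]
      gcongr)
  rw [integral_const_mul] at h
  refine h.trans (le_of_eq ?_)
  ring

lemma bubble_scale {ε : ℝ} (hε : 0 < ε) (s : ℝ) (y : RN N) :
    bubble (ε ^ 2) s (ε • y) = ε ^ (-(2 * s)) * bubble 1 s y := by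
  simp only [bubble]
  rw [norm_smul, Real.norm_of_nonneg hε.le, show (ε * ‖y‖) ^ 2 + ε ^ 2 = ε ^ 2 * (‖y‖ ^ 2 + 1) by
    ring, Real.mul_rpow (by positivity) (by positivity), ← Real.rpow_natCast, ← Real.rpow_mul hε.le]
  congr 2
  push_cast
  ring

lemma integrable_bubble_one (hs : (N : ℝ) < 2 * s) : Integrable (bubble (N := N) 1 s) := by
  have h := integrable_rpow_neg_one_add_norm_sq (E := RN N) (μ := volume) (r := 2 * s)
    (by simpa using hs)
  refine h.congr (Eventually.of_forall fun x => ?_)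
  simp only [bubble]
  rw [add_comm]
  congr 1
  ring

lemma integral_bubble_one_pos (hs : (N : ℝ) < 2 * s) : 0 < ∫ x, bubble (N := N) 1 s x := by
  rw [integral_pos_iff_support_of_nonneg (fun x => (bubble_pos one_pos s x).le)
    (integrable_bubble_one hs)]
  have : Function.support (bubble (N := N) 1 s) = Set.univ := by
    ext x
    simpa using (bubble_pos one_pos s x).ne'
  rw [this]
  exact Measure.measure_univ_pos.2 (NeZero.ne _)

/-- The normalising constant of the fundamental solution of `(-Δ)^m`. -/
noncomputable def rieszConst (N m : ℕ) : ℝ :=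
  bubbleConst m ((N : ℝ) / 2 - m) * ∫ x, bubble (N := N) 1 ((N : ℝ) / 2 + m) x

lemma rieszConst_pos {m : ℕ} (hm : 0 < m) (hN : 2 * m < N) : 0 < rieszConst N m := by
  have h1 : (2 : ℝ) * m < N := by exact_mod_cast hN
  have h2 : (0 : ℝ) < m := by exact_mod_cast hm
  exact mul_pos (bubbleConst_pos m (by linarith)) (integral_bubble_one_pos (by linarith))

/-- The kernel is regularised with τ = ε², (-Δ)^m is moved onto it, and z = εy turns the result into
an integral of f(x - εy) against a fixed integrable profile. Letting ε → 0 on both sides gives the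
identity. -/
lemma conv_bubble_zero_polyharmonic {m : ℕ} (hm : 0 < m) (hN : 2 * m < N)
    (hf : RapidSmooth (2 * m) f) :
    conv (bubble 0 ((N : ℝ) / 2 - m)) (polyharmonic m f) = fun x => rieszConst N m * f x := by
  have h1 : (2 : ℝ) * m < N := by exact_mod_cast hN
  have h2 : (0 : ℝ) < m := by exact_mod_cast hm
  set s : ℝ := (N : ℝ) / 2 - m with hs
  have hs0 : 0 < s := by linarith
  have hpf : RapidSmooth 0 (polyharmonic m f) := RapidSmooth.polyharmonic (by simpa using hf)
  funext x
  have hsq : Tendsto (fun ε : ℝ => ε ^ 2) (𝓝[>] 0) (𝓝[>] 0) := by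
    refine tendsto_nhdsWithin_iff.2 ⟨?_, ?_⟩
    · have : ContinuousAt (fun ε : ℝ => ε ^ 2) 0 := by fun_prop
      simpa using this.tendsto.mono_left nhdsWithin_le_nhds
    · filter_upwards [self_mem_nhdsWithin] with ε hε
      exact pow_pos (Set.mem_Ioi.1 hε) 2
  have hleft : Tendsto (fun ε : ℝ => conv (bubble (ε ^ 2) s) (polyharmonic m f) x) (𝓝[>] 0)
      (𝓝 (conv (bubble 0 s) (polyharmonic m f) x)) := by
    refine tendsto_conv_of_dominated (weightIntegrable_bubble_zero (N := N) hs0.le (by linarith))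
      (Eventually.of_forall fun ε => (measurable_bubble _ _).aestronglyMeasurable) ?_ ?_ hpf.1
      (hpf.2 _) x
    · filter_upwards [self_mem_nhdsWithin] with ε hε
      have hε2 : 0 < ε ^ 2 := pow_pos (Set.mem_Ioi.1 hε) 2
      filter_upwards [ae_ne_zero (by omega)] with z hz
      rw [abs_of_pos (bubble_pos hε2 s z), abs_of_nonneg (bubble_zero_nonneg s z)]
      exact bubble_le_bubble_zero hε2.le hs0.le hz
    · filter_upwards [ae_ne_zero (by omega)] with z hz
      exact (tendsto_bubble_zero s hz).comp hsq
  have heq : ∀ᶠ ε : ℝ in 𝓝[>] 0, conv (bubble (ε ^ 2) s) (polyharmonic m f) x =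
      bubbleConst m s * ∫ y, bubble (N := N) 1 (s + 2 * m) y * f (x - ε • y) := by
    filter_upwards [self_mem_nhdsWithin] with ε (hε : 0 < ε)
    rw [conv_polyharmonic (slowSmooth_bubble (by positivity) hs0.le _) hf,
      polyharmonic_bubble (by positivity) hs0.le (by rw [hs]; ring)]
    simp only [conv]
    have h := Measure.integral_comp_smul_of_nonneg (volume : Measure (RN N))
      (fun z => bubbleConst m s * (ε ^ 2) ^ m * bubble (ε ^ 2) (s + 2 * m) z * f (x - z)) ε
      (hR := hε.le)
    rw [eq_comm, inv_smul_eq_iff₀ (by positivity)] at h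
    rw [h, ← integral_const_mul, smul_eq_mul, ← integral_const_mul]
    refine integral_congr_ae (Eventually.of_forall fun y => ?_)
    simp only [bubble_scale hε]
    -- The Jacobian, τ^m and the scaling of the profile cancel: N + 2m - 2(s + 2m) = 0 since s = N/2
    -- - m.
    have h3 : ε ^ Module.finrank ℝ (RN N) * (ε ^ 2) ^ m * ε ^ (-(2 * (s + 2 * m))) = 1 := by
      rw [finrank_euclideanSpace_fin, ← pow_mul, ← Real.rpow_natCast, ← Real.rpow_natCast,
        ← Real.rpow_add hε, ← Real.rpow_add hε]
      convert Real.rpow_zero ε using 2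
      rw [hs]
      push_cast
      ring
    linear_combination (bubbleConst m s * bubble 1 (s + 2 * m) y * f (x - ε • y)) * h3
  have hright : Tendsto (fun ε : ℝ => bubbleConst m s *
      ∫ y, bubble (N := N) 1 (s + 2 * m) y * f (x - ε • y)) (𝓝[>] 0)
      (𝓝 (bubbleConst m s * ∫ y, bubble (N := N) 1 (s + 2 * m) y * f x)) := by
    refine Tendsto.const_mul _ ?_
    obtain ⟨C, hC⟩ := hf.prop 0
    have hint : Integrable (bubble (N := N) 1 (s + 2 * m)) :=
      integrable_bubble_one (by rw [hs]; linarith)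
    refine tendsto_integral_filter_of_dominated_convergence
      (fun y => bubble (N := N) 1 (s + 2 * m) y * C) ?_ ?_ (hint.mul_const C) ?_
    · refine Eventually.of_forall fun ε => hint.aestronglyMeasurable.mul ?_
      have := hf.continuous
      exact (by fun_prop : Continuous fun y : RN N => f (x - ε • y)).aestronglyMeasurable
    · refine Eventually.of_forall fun ε => Eventually.of_forall fun y => ?_
      rw [norm_mul, Real.norm_of_nonneg (bubble_pos one_pos _ y).le]
      have := hC (x - ε • y)
      rw [Real.rpow_zero, mul_one] at this
      exact mul_le_mul_of_nonneg_left this (bubble_pos one_pos _ y).le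
    · refine Eventually.of_forall fun y => Tendsto.const_mul _ ?_
      have hc : ContinuousAt (fun ε : ℝ => f (x - ε • y)) 0 := by
        have := hf.continuous
        fun_prop
      simpa using hc.tendsto.mono_left nhdsWithin_le_nhds
  have := tendsto_nhds_unique (hleft.congr' heq) hright
  rw [this, integral_mul_const, rieszConst, show (N : ℝ) / 2 + m = s + 2 * m by rw [hs]; ring]
  ring

end kernel

/-! ### Gain of a derivative under Riesz potentials -/

section regularity

variable {s : ℝ} {f : RN N → ℝ}

/-- The integrated form of differentiability survives pointwise dominated limits, so it is the form
in which τ → 0 is taken below. -/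
lemma hasFDerivAt_of_sub_eq_integral {F : RN N → ℝ} {D : RN N → RN N →L[ℝ] ℝ}
    (hD : Continuous D) (hF : ∀ x h, F (x + h) - F x = ∫ t in (0 : ℝ)..1, D (x + t • h) h)
    (x : RN N) : HasFDerivAt F (D x) x := by
  rw [hasFDerivAt_iff_isLittleO_nhds_zero, Asymptotics.isLittleO_iff]
  intro c hc
  obtain ⟨δ, hδ, hball⟩ := Metric.continuousAt_iff.1 (hD.continuousAt (x := x)) c hc
  filter_upwards [Metric.ball_mem_nhds (0 : RN N) hδ] with h hh
  have hcont : Continuous fun t : ℝ => D (x + t • h) h := by fun_prop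
  have h1 : F (x + h) - F x - D x h = ∫ t in (0 : ℝ)..1, (D (x + t • h) h - D x h) := by
    rw [intervalIntegral.integral_sub (hcont.intervalIntegrable _ _) (by simp), hF]
    simp
  rw [h1]
  refine (intervalIntegral.norm_integral_le_of_norm_le_const (C := c * ‖h‖) ?_).trans (by simp)
  intro t ht
  rw [Set.uIoc_of_le zero_le_one] at ht
  have ht1 : dist (x + t • h) x < δ := by
    rw [dist_eq_norm, add_sub_cancel_left, norm_smul, Real.norm_of_nonneg ht.1.le]
    rw [mem_ball_zero_iff] at hh
    nlinarith [norm_nonneg h, ht.2]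
  have h2 := hball ht1
  rw [dist_eq_norm] at h2
  calc ‖D (x + t • h) h - D x h‖ = ‖(D (x + t • h) - D x) h‖ := rfl
    _ ≤ ‖D (x + t • h) - D x‖ * ‖h‖ := ContinuousLinearMap.le_opNorm _ _
    _ ≤ c * ‖h‖ := by gcongr

/-- The gradient of the regularised kernel is dominated, uniformly in τ, by a multiple of
|z|^{-2s-1}, which is locally integrable when 2s + 1 < N. -/
lemma abs_coord_mul_bubble_le {τ : ℝ} (hτ : 0 ≤ τ) (hs : 0 ≤ s) (i : Fin N) {z : RN N}
    (hz : z ≠ 0) : |-2 * s * (z i * bubble τ (s + 1) z)| ≤ |2 * s * bubble 0 (s + 1 / 2) z| := by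
  have hz0 : 0 < ‖z‖ := norm_pos_iff.2 hz
  have h1 : ‖z‖ * bubble 0 (s + 1) z = bubble 0 (s + 1 / 2) z := by
    rw [bubble_zero_eq, bubble_zero_eq]
    nth_rewrite 1 [← Real.rpow_one ‖z‖]
    rw [← Real.rpow_add hz0]
    congr 1
    ring
  have h2 : |z i| ≤ ‖z‖ := PiLp.norm_apply_le z i
  have h3 : 0 ≤ bubble τ (s + 1) z := Real.rpow_nonneg (by positivity) _
  rw [abs_of_nonneg (mul_nonneg (by positivity) (bubble_zero_nonneg _ z)), abs_mul, abs_mul,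
    abs_mul, abs_of_nonneg hs, abs_of_nonneg h3, ← h1]
  norm_num
  gcongr
  exact bubble_le_bubble_zero hτ (by linarith) hz

/-- Convolving a rapidly decreasing continuous function with a Riesz kernel gains one derivative. -/
lemma slowSmooth_one_conv_bubble_zero (hs : 0 ≤ s) (hN : 2 * s + 1 < N) (hf : RapidSmooth 0 f) :
    SlowSmooth 1 (conv (bubble 0 s) f) ∧ ∀ i, pd i (conv (bubble 0 s) f) =
      conv (fun z => -2 * s * (z i * bubble 0 (s + 1) z)) f := by
  have hN0 : 0 < N := by
    have : (0 : ℝ) < N := by linarith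
    exact_mod_cast this
  set L : ℝ → Fin N → RN N → ℝ := fun τ i z => -2 * s * (z i * bubble τ (s + 1) z) with hL
  set b : RN N → ℝ := fun z => 2 * s * bubble 0 (s + 1 / 2) z with hb
  have hmeas : ∀ τ i, AEStronglyMeasurable (L τ i) := fun τ i => by
    have := measurable_bubble (N := N) τ (s + 1)
    have h2 : Measurable fun z : RN N => z i := by fun_prop
    exact ((h2.mul this).const_mul _).aestronglyMeasurable
  have hbi : WeightIntegrable (-(N + 1)) b := by
    have := (weightIntegrable_bubble_zero (N := N) (s := s + 1 / 2) (by linarith)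
      (by linarith)).const_mul (2 * s)
    refine this.congr (Eventually.of_forall fun z => ?_)
    simp only [hb]
    ring
  have hle : ∀ τ : ℝ, 0 ≤ τ → ∀ i, ∀ᵐ z, |L τ i z| ≤ |b z| := fun τ hτ i => by
    filter_upwards [ae_ne_zero hN0] with z hz
    exact abs_coord_mul_bubble_le hτ hs i hz
  have hLint : ∀ i, WeightIntegrable (-(N + 1)) (L 0 i) := fun i => by
    refine Integrable.mono hbi ((hmeas 0 i).mul (continuous_weight _).aestronglyMeasurable) ?_
    filter_upwards [hle 0 le_rfl i] with z hz
    rw [norm_mul (L 0 i z), norm_mul (b z)]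
    exact mul_le_mul_of_nonneg_right hz (abs_nonneg ((1 + ‖z‖) ^ (-((N : ℝ) + 1))))
  have hK := weightIntegrable_bubble_zero (N := N) (s := s) hs (by linarith)
  set V : Fin N → RN N → ℝ := fun i => conv (L 0 i) f with hV
  have hVcont : ∀ i, Continuous (V i) := fun i => (hLint i).continuous_conv hf.1 (hf.2 _)
  set D : RN N → RN N →L[ℝ] ℝ := fun x => ∑ i, V i x • (EuclideanSpace.proj i : RN N →L[ℝ] ℝ)
    with hD
  have hDcont : Continuous D := by fun_prop
  have hDapply : ∀ x h, D x h = ∑ i, V i x * h i := fun x h => by simp [hD]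
  obtain ⟨C, hC0, hC⟩ := (hf.2 (-(N + 1))).exists_nonneg
  -- For τ > 0 the kernel is smooth and this is the fundamental theorem of calculus along the
  -- segment from x to x + h. Both sides are later passed to the limit τ → 0.
  have hreg : ∀ τ : ℝ, 0 < τ → ∀ x h, conv (bubble τ s) f (x + h) - conv (bubble τ s) f x =
      ∫ t in (0 : ℝ)..1, ∑ i, conv (L τ i) f (x + t • h) * h i := by
    intro τ hτ x h
    have hsm := slowSmooth_bubble (N := N) hτ hs 1
    have hd := pd_conv_slow hsm hf
    have hpd : ∀ i, pd i (conv (bubble τ s) f) = conv (L τ i) f := fun i => by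
      rw [hd.2, pd_bubble hτ]
    have hcc : ∀ i, Continuous (conv (L τ i) f) := fun i => by
      have h1 : L τ i = pd i (bubble τ s) := (pd_bubble hτ s i).symm
      rw [h1]
      obtain ⟨p, hp⟩ := (hsm.2 i).2.weightIntegrable (hsm.2 i).1
      exact hp.continuous_conv hf.1 (hf.2 p)
    have hder : ∀ t ∈ Set.uIcc (0 : ℝ) 1, HasDerivAt (fun t : ℝ => conv (bubble τ s) f (x + t • h))
        (∑ i, conv (L τ i) f (x + t • h) * h i) t := by
      intro t _
      have h1 : HasDerivAt (fun t : ℝ => x + t • h) h t := by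
        simpa using ((hasDerivAt_id t).smul_const h).const_add x
      have h2 := (hd.1 (x + t • h)).hasFDerivAt.comp_hasDerivAt t h1
      rw [fderiv_apply_eq_sum_pd] at h2
      simp_rw [hpd, mul_comm (h _)] at h2
      exact h2
    rw [intervalIntegral.integral_eq_sub_of_hasDerivAt hder
      (Continuous.intervalIntegrable (by fun_prop) _ _)]
    simp
  have hlimK : ∀ x, Tendsto (fun τ => conv (bubble τ s) f x) (𝓝[>] 0)
      (𝓝 (conv (bubble 0 s) f x)) := by
    intro x
    refine tendsto_conv_of_dominated hK
      (Eventually.of_forall fun τ => (measurable_bubble _ _).aestronglyMeasurable) ?_ ?_ hf.1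
      (hf.2 _) x
    · filter_upwards [self_mem_nhdsWithin] with τ (hτ : 0 < τ)
      filter_upwards [ae_ne_zero hN0] with z hz
      rw [abs_of_pos (bubble_pos hτ s z), abs_of_nonneg (bubble_zero_nonneg s z)]
      exact bubble_le_bubble_zero hτ.le hs hz
    · filter_upwards [ae_ne_zero hN0] with z hz
      exact tendsto_bubble_zero s hz
  have hlimL : ∀ i x, Tendsto (fun τ => conv (L τ i) f x) (𝓝[>] 0) (𝓝 (V i x)) := by
    intro i x
    refine tendsto_conv_of_dominated hbi (Eventually.of_forall fun τ => hmeas τ i) ?_ ?_ hf.1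
      (hf.2 _) x
    · filter_upwards [self_mem_nhdsWithin] with τ (hτ : 0 < τ) using hle τ hτ.le i
    · filter_upwards [ae_ne_zero hN0] with z hz
      exact ((tendsto_bubble_zero (s + 1) hz).const_mul _).const_mul _
  have hFTC : ∀ x h, conv (bubble 0 s) f (x + h) - conv (bubble 0 s) f x =
      ∫ t in (0 : ℝ)..1, D (x + t • h) h := by
    intro x h
    have hl := (hlimK (x + h)).sub (hlimK x)
    have hr : Tendsto (fun τ => ∫ t in (0 : ℝ)..1, ∑ i, conv (L τ i) f (x + t • h) * h i)
        (𝓝[>] 0) (𝓝 (∫ t in (0 : ℝ)..1, D (x + t • h) h)) := by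
      have hDint : Continuous fun t : ℝ => ∑ i : Fin N,
          C * (∫ z, |b z * (1 + ‖z‖) ^ (-((N : ℝ) + 1))|) *
            (1 + ‖x + t • h‖) ^ |(-((N : ℝ) + 1))| * |h i| := by
        refine continuous_finsetSum _ fun i _ => (continuous_const.mul ?_).mul continuous_const
        exact (continuous_weight (N := N) |(-((N : ℝ) + 1))|).comp (by fun_prop)
      refine intervalIntegral.tendsto_integral_filter_of_dominated_convergence
        (fun t => ∑ i : Fin N, C * (∫ z, |b z * (1 + ‖z‖) ^ (-((N : ℝ) + 1))|) *
          (1 + ‖x + t • h‖) ^ |(-((N : ℝ) + 1))| * |h i|) ?_ ?_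
        (hDint.intervalIntegrable _ _) ?_
      · filter_upwards [self_mem_nhdsWithin] with τ (hτ : 0 < τ)
        have hcc : ∀ i, Continuous (conv (L τ i) f) := fun i => by
          have hsm := slowSmooth_bubble (N := N) hτ hs 1
          have h1 : L τ i = pd i (bubble τ s) := (pd_bubble hτ s i).symm
          rw [h1]
          obtain ⟨p, hp⟩ := (hsm.2 i).2.weightIntegrable (hsm.2 i).1
          exact hp.continuous_conv hf.1 (hf.2 p)
        exact (by fun_prop : Continuous fun t : ℝ =>
          ∑ i, conv (L τ i) f (x + t • h) * h i).aestronglyMeasurable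
      · filter_upwards [self_mem_nhdsWithin] with τ (hτ : 0 < τ)
        refine Eventually.of_forall fun t _ => (norm_sum_le _ _).trans
          (Finset.sum_le_sum fun i _ => ?_)
        rw [norm_mul]
        exact mul_le_mul_of_nonneg_right
          (abs_conv_le_of_dominated hbi (hle τ hτ.le i) hC0 hC _) (norm_nonneg _)
      · refine Eventually.of_forall fun t _ => ?_
        rw [hDapply]
        exact tendsto_finsetSum _ fun i _ => (hlimL i _).mul_const _
    refine tendsto_nhds_unique hl (hr.congr' ?_)
    filter_upwards [self_mem_nhdsWithin] with τ (hτ : 0 < τ) using (hreg τ hτ x h).symm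
  have hfd := hasFDerivAt_of_sub_eq_integral hDcont hFTC
  have hpd : ∀ i, pd i (conv (bubble 0 s) f) = V i := fun i => by
    funext x
    rw [pd, (hfd x).fderiv, hDapply]
    simp
  refine ⟨⟨⟨fun x => (hfd x).differentiableAt, _, hK.hasGrowth_conv (hf.2 _)⟩, fun i => ?_⟩, hpd⟩
  rw [hpd]
  exact ⟨hVcont i, _, (hLint i).hasGrowth_conv (hf.2 _)⟩

/-- The first k derivatives are put on f; the last one is taken by the kernel. -/
lemma slowSmooth_succ_conv_bubble_zero (hs : 0 ≤ s) (hN : 2 * s + 1 < N) {k : ℕ}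
    (hf : RapidSmooth k f) : SlowSmooth (k + 1) (conv (bubble 0 s) f) := by
  induction k generalizing f with
  | zero => exact (slowSmooth_one_conv_bubble_zero hs hN hf).1
  | succ k ih =>
    have hK := weightIntegrable_bubble_zero (N := N) (s := s) hs (by linarith)
    have h1 := slowSmooth_one_conv_bubble_zero hs hN (hf.of_le (Nat.zero_le _))
    refine ⟨h1.1.1, fun i => ?_⟩
    rw [hK.pd_conv (hf.of_le (by omega))]
    exact ih (hf.2 i)

end regularity

/-! ### Decay of Riesz potentials and of e^{-P} -/

section decay

variable {s : ℝ}

/-- Inside the unit ball the weight is at most 2^{2s} and w ≤ 1; outside, 1 + ‖z‖ ≤ 2‖z‖ cancels the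
kernel. With w a translate of an integrable function, the right side has an integral independent of
the translation. -/
lemma one_add_norm_rpow_mul_bubble_zero_le (hs : 0 ≤ s) (z : RN N) {w : ℝ} (hw0 : 0 ≤ w)
    (hw1 : w ≤ 1) : bubble 0 s z * (1 + ‖z‖) ^ (2 * s) * w ≤
      2 ^ (2 * s) * (w + (Metric.ball (0 : RN N) 1).indicator (bubble 0 s) z) := by
  have hb := bubble_zero_nonneg s z
  by_cases hz : z ∈ Metric.ball (0 : RN N) 1
  · rw [Set.indicator_of_mem hz]
    have h1 : (1 + ‖z‖) ^ (2 * s) ≤ 2 ^ (2 * s) := by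
      refine Real.rpow_le_rpow (one_add_norm_pos z).le ?_ (by linarith)
      rw [mem_ball_zero_iff] at hz
      linarith
    calc bubble 0 s z * (1 + ‖z‖) ^ (2 * s) * w ≤ bubble 0 s z * 2 ^ (2 * s) * 1 := by gcongr
      _ = 2 ^ (2 * s) * bubble 0 s z := by ring
      _ ≤ _ := by gcongr; linarith
  · rw [Set.indicator_of_notMem hz, add_zero]
    have hz1 : 1 ≤ ‖z‖ := by simpa using hz
    have h1 : bubble 0 s z * (1 + ‖z‖) ^ (2 * s) ≤ 2 ^ (2 * s) := by
      calc bubble 0 s z * (1 + ‖z‖) ^ (2 * s) ≤ ‖z‖ ^ (-(2 * s)) * (2 * ‖z‖) ^ (2 * s) := by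
            rw [bubble_zero_eq]
            gcongr
            linarith
        _ = 2 ^ (2 * s) := by
            rw [Real.mul_rpow (by norm_num) (by linarith), mul_left_comm,
              ← Real.rpow_add (by linarith)]
            simp
    gcongr

/-- A Riesz potential of a rapidly decaying function decays like the kernel. -/
lemma exists_abs_conv_bubble_zero_le (hs : 0 ≤ s) (hN : 2 * s < N) :
    ∃ A : ℝ, 0 ≤ A ∧ ∀ (C : ℝ) (f : RN N → ℝ),
      (∀ y, |f y| ≤ C * (1 + ‖y‖) ^ (-(2 * s + N + 1))) →
      ∀ x, |conv (bubble 0 s) f x| ≤ C * A * (1 + ‖x‖ ^ 2) ^ (-s) := by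
  have hN0 : 0 < N := by
    have : (0 : ℝ) < N := by linarith
    exact_mod_cast this
  have h1 : IntegrableOn (bubble (N := N) 0 s) (Metric.ball 0 1) :=
    integrableOn_ball_of_norm_le_rpow (C := 1) (α := 2 * s)
      (by rw [finrank_euclideanSpace_fin]; exact hN0) (by simpa using hN)
      (Eventually.of_forall fun x => by
        rw [Real.norm_of_nonneg (bubble_zero_nonneg s x), bubble_zero_eq, one_mul])
      (measurable_bubble 0 s).aestronglyMeasurable
  have h2 : Integrable fun z : RN N => (1 + ‖z‖) ^ (-((N : ℝ) + 1)) :=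
    integrable_one_add_norm (by simp)
  rw [← integrable_indicator_iff Metric.isOpen_ball.measurableSet] at h1
  set w : RN N → ℝ := fun z => (1 + ‖z‖) ^ (-((N : ℝ) + 1)) with hw
  set I : RN N → ℝ := (Metric.ball (0 : RN N) 1).indicator (bubble 0 s) with hI
  have hw0 : ∀ z, 0 ≤ w z := fun z => Real.rpow_nonneg (one_add_norm_pos z).le _
  have hw1 : ∀ z, w z ≤ 1 := fun z =>
    Real.rpow_le_one_of_one_le_of_nonpos (one_le_one_add_norm z) (by linarith)
  refine ⟨2 ^ (2 * s) * ((∫ z, w z) + ∫ z, I z), ?_, fun C f hf x => ?_⟩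
  · refine mul_nonneg (by positivity) (add_nonneg (integral_nonneg hw0) (integral_nonneg fun z => ?_))
    exact Set.indicator_nonneg (fun z _ => bubble_zero_nonneg s z) z
  have hC0 : 0 ≤ C := by
    have h := (abs_nonneg _).trans (hf 0)
    simpa using h
  have hint : Integrable fun z => w (x - z) + I z := (h2.comp_sub_left x).add h1
  have hptw : ∀ z, ‖bubble 0 s z * f (x - z)‖ ≤
      C * (1 + ‖x‖) ^ (-(2 * s)) * 2 ^ (2 * s) * (w (x - z) + I z) := by
    intro z
    -- Of the decay of f, the part of order 2s is transferred to x at the price (1 + ‖z‖)^{2s},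
    -- which the kernel pays for; the remaining order N + 1 gives integrability.
    have h3 := weight_sub_le (-(2 * s)) z x
    rw [norm_sub_rev, abs_neg, abs_of_nonneg (by linarith : 0 ≤ 2 * s)] at h3
    have h4 := one_add_norm_rpow_mul_bubble_zero_le hs z (hw0 (x - z)) (hw1 (x - z))
    have h5 : (1 + ‖x - z‖) ^ (-(2 * s + N + 1)) = (1 + ‖x - z‖) ^ (-(2 * s)) * w (x - z) := by
      rw [hw, ← Real.rpow_add (one_add_norm_pos _)]
      congr 1
      ring
    rw [norm_mul, Real.norm_of_nonneg (bubble_zero_nonneg s z)]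
    calc bubble 0 s z * ‖f (x - z)‖
        ≤ bubble 0 s z * (C * ((1 + ‖x - z‖) ^ (-(2 * s)) * w (x - z))) := by
          rw [← h5]
          exact mul_le_mul_of_nonneg_left (hf _) (bubble_zero_nonneg s z)
      _ ≤ bubble 0 s z * (C * (((1 + ‖z‖) ^ (2 * s) * (1 + ‖x‖) ^ (-(2 * s))) * w (x - z))) := by
          have := bubble_zero_nonneg s z
          have := hw0 (x - z)
          gcongr
      _ = C * (1 + ‖x‖) ^ (-(2 * s)) * (bubble 0 s z * (1 + ‖z‖) ^ (2 * s) * w (x - z)) := by ring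
      _ ≤ C * (1 + ‖x‖) ^ (-(2 * s)) * (2 ^ (2 * s) * (w (x - z) + I z)) := by
          exact mul_le_mul_of_nonneg_left h4 (by positivity)
      _ = _ := by ring
  have h6 := norm_integral_le_of_norm_le (f := fun z => bubble 0 s z * f (x - z))
    (hint.const_mul (C * (1 + ‖x‖) ^ (-(2 * s)) * 2 ^ (2 * s))) (Eventually.of_forall hptw)
  have h7 : ∫ z, w (x - z) + I z = (∫ z, w z) + ∫ z, I z := by
    rw [integral_add (h2.comp_sub_left x) h1, integral_sub_left_eq_self w volume x]
  rw [integral_const_mul, h7] at h6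
  have h8 : (1 + ‖x‖) ^ (-(2 * s)) ≤ (1 + ‖x‖ ^ 2) ^ (-s) := by
    rw [show -(2 * s) = ((2 : ℕ) : ℝ) * (-s) by push_cast; ring,
      Real.rpow_mul (one_add_norm_pos x).le, Real.rpow_natCast]
    refine Real.rpow_le_rpow_of_nonpos (by positivity) ?_ (by linarith)
    nlinarith [norm_nonneg x]
  have h9 : 0 ≤ (∫ z, w z) + ∫ z, I z :=
    add_nonneg (integral_nonneg hw0) (integral_nonneg fun z =>
      Set.indicator_nonneg (fun z _ => bubble_zero_nonneg s z) z)
  calc |conv (bubble 0 s) f x|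
      ≤ C * (1 + ‖x‖) ^ (-(2 * s)) * 2 ^ (2 * s) * ((∫ z, w z) + ∫ z, I z) := h6
    _ ≤ C * (1 + ‖x‖ ^ 2) ^ (-s) * 2 ^ (2 * s) * ((∫ z, w z) + ∫ z, I z) := by gcongr
    _ = _ := by ring

/-- Far out g ≥ |p| ln‖x‖, hence e^{-g} ≤ ‖x‖^{-|p|}; the remaining ball is compact. Its radius is
at least 2, so that the logarithm is positive outside it. -/
lemma isRapid_exp_neg_of_tendsto {g : RN N → ℝ} (hg : Continuous g)
    (h : Tendsto (fun x : RN N => g x / Real.log ‖x‖) (Bornology.cobounded (RN N)) atTop) :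
    IsRapid fun x => Real.exp (-g x) := by
  intro p
  have h1 := h.eventually_ge_atTop |p|
  obtain ⟨R, hR⟩ : ∃ R : ℝ, ∀ x : RN N, R ≤ ‖x‖ → |p| ≤ g x / Real.log ‖x‖ := by
    rw [← comap_norm_atTop] at h1
    obtain ⟨t, ht, hts⟩ := mem_comap.1 h1
    obtain ⟨R, hR⟩ := mem_atTop_sets.1 ht
    exact ⟨R, fun x hx => hts (hR _ hx)⟩
  have hcont : Continuous fun x : RN N => Real.exp (-g x) * (1 + ‖x‖) ^ (-p) :=
    (Real.continuous_exp.comp hg.neg).mul (continuous_weight _)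
  obtain ⟨C, hC⟩ := (isCompact_closedBall (0 : RN N) (max R 2)).exists_bound_of_continuousOn
    hcont.continuousOn
  refine ⟨max C (2 ^ |p|), fun x => ?_⟩
  have hw : 0 < (1 + ‖x‖) ^ p := Real.rpow_pos_of_pos (one_add_norm_pos x) _
  rw [abs_of_pos (Real.exp_pos _)]
  by_cases hx : ‖x‖ ≤ max R 2
  · have h2 := hC x (by simpa using hx)
    rw [Real.norm_of_nonneg (by positivity), Real.rpow_neg (one_add_norm_pos x).le,
      ← div_eq_mul_inv, div_le_iff₀ hw] at h2
    exact h2.trans (mul_le_mul_of_nonneg_right (le_max_left _ _) hw.le)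
  · have hxR : R ≤ ‖x‖ := (le_max_left R 2).trans (not_le.1 hx).le
    have hx2 : 2 ≤ ‖x‖ := (le_max_right R 2).trans (not_le.1 hx).le
    have hlog : 0 < Real.log ‖x‖ := Real.log_pos (by linarith)
    have h2 := (le_div_iff₀ hlog).1 (hR x hxR)
    have h3 : Real.exp (-g x) ≤ ‖x‖ ^ (-|p|) := by
      rw [Real.rpow_def_of_pos (by linarith)]
      exact Real.exp_le_exp.2 (by linarith)
    have h4 : ‖x‖ ^ (-|p|) ≤ 2 ^ |p| * (1 + ‖x‖) ^ (-|p|) := by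
      have h5 : (1 + ‖x‖) ^ |p| ≤ 2 ^ |p| * ‖x‖ ^ |p| := by
        rw [← Real.mul_rpow (by norm_num) (by linarith)]
        exact Real.rpow_le_rpow (one_add_norm_pos x).le (by linarith) (abs_nonneg p)
      rw [Real.rpow_neg (by linarith), Real.rpow_neg (one_add_norm_pos x).le, ← div_eq_mul_inv,
        le_div_iff₀ (Real.rpow_pos_of_pos (one_add_norm_pos x) _), inv_mul_le_iff₀
        (Real.rpow_pos_of_pos (by linarith) _)]
      linarith
    calc Real.exp (-g x) ≤ 2 ^ |p| * (1 + ‖x‖) ^ (-|p|) := h3.trans h4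
      _ ≤ 2 ^ |p| * (1 + ‖x‖) ^ p := by
          gcongr
          · exact one_le_one_add_norm x
          · exact neg_abs_le p
      _ ≤ _ := mul_le_mul_of_nonneg_right (le_max_right _ _) hw.le

end decay

/-! ### Existence by contraction, and bootstrap -/

section existence

open BoundedContinuousFunction

lemma abs_exp_sub_exp_le {a b : ℝ} (ha : a ≤ 1) (hb : b ≤ 1) :
    |Real.exp a - Real.exp b| ≤ Real.exp 1 * |a - b| := by
  have key : ∀ {a b : ℝ}, a ≤ 1 → b ≤ a → |Real.exp a - Real.exp b| ≤ Real.exp 1 * |a - b| := by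
    intro a b ha hab
    rw [abs_of_nonneg (by linarith [Real.exp_le_exp.2 hab]), abs_of_nonneg (by linarith)]
    have h1 : Real.exp b = Real.exp a * Real.exp (b - a) := by rw [← Real.exp_add]; ring_nf
    have h2 := Real.add_one_le_exp (b - a)
    have h3 := Real.exp_le_exp.2 ha
    calc Real.exp a - Real.exp b ≤ Real.exp a * (a - b) := by
          rw [h1]
          nlinarith [Real.exp_pos a]
      _ ≤ Real.exp 1 * (a - b) := by
          gcongr
  rcases le_total b a with h | h
  · exact key ha h
  · rw [abs_sub_comm, abs_sub_comm a]
    exact key hb h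

/-- Existence of a fixed point of `v ↦ κ |x|^{-2s} * (g e^v)` below the barrier, for small `g`. -/
lemma exists_fixedPoint_conv {s A κ δ : ℝ} (hs : 0 ≤ s) (hN : 2 * s < N) (hκ : 0 ≤ κ)
    (hA : ∀ (C : ℝ) (f : RN N → ℝ), (∀ y, |f y| ≤ C * (1 + ‖y‖) ^ (-(2 * s + N + 1))) →
      ∀ x, |conv (bubble 0 s) f x| ≤ C * A * (1 + ‖x‖ ^ 2) ^ (-s))
    {g : RN N → ℝ} (hg : Continuous g) (hg0 : ∀ x, 0 ≤ g x) (hgr : IsRapid g)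
    (hgδ : ∀ y, g y ≤ δ * (1 + ‖y‖) ^ (-(2 * s + N + 1)))
    (hδ : κ * (Real.exp 1 * δ * A) ≤ 1 / 2) :
    ∃ v : RN N → ℝ, Continuous v ∧ (∀ x, 0 ≤ v x) ∧ (∀ x, v x ≤ (1 + ‖x‖ ^ 2) ^ (-s)) ∧
      ∀ x, v x = κ * conv (bubble 0 s) (fun y => g y * Real.exp (v y)) x := by
  -- Truncating to [0, 1] defines the map on all bounded continuous functions and keeps the
  -- exponential Lipschitz with constant e. The fixed point lies in [0, 1], so the truncation
  -- disappears at the end.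
  set cl : ℝ → ℝ := fun r => max 0 (min r 1) with hcl
  have hcl_cont : Continuous cl := by fun_prop
  have hcl0 : ∀ r, 0 ≤ cl r := fun r => le_max_left _ _
  have hcl1 : ∀ r, cl r ≤ 1 := fun r => max_le zero_le_one (min_le_right _ _)
  have hcl_lip : ∀ a b, |cl a - cl b| ≤ |a - b| := by
    intro a b
    refine (abs_max_sub_max_le_max _ _ _ _).trans ?_
    rw [sub_self, abs_zero, max_eq_right (abs_nonneg _)]
    refine (abs_min_sub_min_le_max _ _ _ _).trans ?_
    simp
  have hcl_id : ∀ r, 0 ≤ r → r ≤ 1 → cl r = r := fun r h0 h1 => by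
    simp [hcl, min_eq_left h1, max_eq_right h0]
  have hbar : ∀ x : RN N, (1 + ‖x‖ ^ 2) ^ (-s) ≤ 1 := fun x =>
    Real.rpow_le_one_of_one_le_of_nonpos (by nlinarith [sq_nonneg ‖x‖]) (by linarith)
  have hbar0 : ∀ x : RN N, 0 ≤ (1 + ‖x‖ ^ 2) ^ (-s) := fun x => by positivity
  have hK := weightIntegrable_bubble_zero (N := N) (s := s) hs hN
  set F : (RN N → ℝ) → RN N → ℝ := fun v y => g y * Real.exp (cl (v y)) with hF
  have hFle : ∀ v y, |F v y| ≤ |Real.exp 1 * g y| := fun v y => by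
    rw [abs_of_nonneg (mul_nonneg (hg0 y) (Real.exp_pos _).le),
      abs_of_nonneg (mul_nonneg (Real.exp_pos _).le (hg0 y)), mul_comm (Real.exp 1)]
    exact mul_le_mul_of_nonneg_left (Real.exp_le_exp.2 (hcl1 _)) (hg0 y)
  have hFr : ∀ v, IsRapid (F v) := fun v p =>
    ((isSlow_const (Real.exp 1)).mul_rapid hgr p).of_abs_le (hFle v)
  have hFc : ∀ v, Continuous v → Continuous (F v) := fun v hv =>
    hg.mul (Real.continuous_exp.comp (hcl_cont.comp hv))
  have hFδ : ∀ v y, |F v y| ≤ Real.exp 1 * δ * (1 + ‖y‖) ^ (-(2 * s + N + 1)) := fun v y => by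
    refine (hFle v y).trans ?_
    rw [abs_of_nonneg (mul_nonneg (Real.exp_pos _).le (hg0 y)), mul_assoc]
    exact mul_le_mul_of_nonneg_left (hgδ y) (Real.exp_pos _).le
  have hTle : ∀ v x, |κ * conv (bubble 0 s) (F v) x| ≤ (1 + ‖x‖ ^ 2) ^ (-s) := fun v x => by
    rw [abs_mul, abs_of_nonneg hκ]
    calc κ * |conv (bubble 0 s) (F v) x|
        ≤ κ * (Real.exp 1 * δ * A * (1 + ‖x‖ ^ 2) ^ (-s)) :=
          mul_le_mul_of_nonneg_left (hA _ _ (hFδ v) x) hκ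
      _ = κ * (Real.exp 1 * δ * A) * (1 + ‖x‖ ^ 2) ^ (-s) := by ring
      _ ≤ 1 / 2 * (1 + ‖x‖ ^ 2) ^ (-s) := mul_le_mul_of_nonneg_right hδ (hbar0 x)
      _ ≤ _ := by linarith [hbar0 x]
  have hTc : ∀ v, Continuous v → Continuous fun x => κ * conv (bubble 0 s) (F v) x :=
    fun v hv => continuous_const.mul (hK.continuous_conv (hFc v hv) (hFr v _))
  let T : (RN N →ᵇ ℝ) → (RN N →ᵇ ℝ) := fun v =>
    BoundedContinuousFunction.ofNormedAddCommGroup (fun x => κ * conv (bubble 0 s) (F v) x)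
      (hTc v v.continuous) 1 fun x => (hTle v x).trans (hbar x)
  have hT : ∀ v x, T v x = κ * conv (bubble 0 s) (F v) x := fun v x => rfl
  have hcontr : ContractingWith (1 / 2) T := by
    refine ⟨by rw [← NNReal.coe_lt_coe]; norm_num, LipschitzWith.of_dist_le_mul fun v w => ?_⟩
    rw [BoundedContinuousFunction.dist_le (by positivity)]
    intro x
    rw [hT, hT, Real.dist_eq, ← mul_sub, abs_mul, abs_of_nonneg hκ]
    have h1 : conv (bubble 0 s) (F v) x - conv (bubble 0 s) (F w) x =
        conv (bubble 0 s) (fun y => F v y - F w y) x := by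
      simp only [conv, mul_sub]
      rw [integral_sub (hK.integrable_conv (hFc v v.continuous) (hFr v _) x)
        (hK.integrable_conv (hFc w w.continuous) (hFr w _) x)]
    -- The difference of sources obeys the same decay bound with the extra factor `dist v w`, so the
    -- potential estimate `hA` gives the Lipschitz constant as well.
    have h2 : ∀ y, |F v y - F w y| ≤
        Real.exp 1 * δ * dist v w * (1 + ‖y‖) ^ (-(2 * s + N + 1)) := by
      intro y
      simp only [hF]
      rw [← mul_sub, abs_mul, abs_of_nonneg (hg0 y)]
      have h3 : |Real.exp (cl (v y)) - Real.exp (cl (w y))| ≤ Real.exp 1 * dist v w := by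
        refine (abs_exp_sub_exp_le (hcl1 _) (hcl1 _)).trans ?_
        gcongr
        refine (hcl_lip _ _).trans ?_
        rw [← Real.dist_eq]
        exact BoundedContinuousFunction.dist_coe_le_dist y
      calc g y * |Real.exp (cl (v y)) - Real.exp (cl (w y))|
          ≤ g y * (Real.exp 1 * dist v w) := mul_le_mul_of_nonneg_left h3 (hg0 y)
        _ ≤ δ * (1 + ‖y‖) ^ (-(2 * s + N + 1)) * (Real.exp 1 * dist v w) :=
            mul_le_mul_of_nonneg_right (hgδ y) (by positivity)
        _ = _ := by ring
    rw [h1]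
    calc κ * |conv (bubble 0 s) (fun y => F v y - F w y) x|
        ≤ κ * (Real.exp 1 * δ * dist v w * A * (1 + ‖x‖ ^ 2) ^ (-s)) :=
          mul_le_mul_of_nonneg_left (hA _ _ h2 x) hκ
      _ = κ * (Real.exp 1 * δ * A) * (dist v w * (1 + ‖x‖ ^ 2) ^ (-s)) := by ring
      _ ≤ 1 / 2 * (dist v w * (1 + ‖x‖ ^ 2) ^ (-s)) :=
          mul_le_mul_of_nonneg_right hδ (mul_nonneg dist_nonneg (hbar0 x))
      _ ≤ 1 / 2 * (dist v w * 1) := by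
          gcongr
          exact hbar x
      _ = _ := by push_cast; ring
  obtain ⟨v, hv⟩ : ∃ v, T v = v := ⟨_, hcontr.fixedPoint_isFixedPt⟩
  have hfix : ∀ x, v x = κ * conv (bubble 0 s) (F v) x := fun x => by
    rw [← hT, hv]
  have hv0 : ∀ x, 0 ≤ v x := fun x => by
    rw [hfix]
    exact mul_nonneg hκ (integral_nonneg fun z =>
      mul_nonneg (bubble_zero_nonneg s z) (mul_nonneg (hg0 _) (Real.exp_pos _).le))
  have hv1 : ∀ x, v x ≤ (1 + ‖x‖ ^ 2) ^ (-s) := fun x => by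
    rw [hfix]
    exact (le_abs_self _).trans (hTle v x)
  refine ⟨v, v.continuous, hv0, hv1, fun x => ?_⟩
  have hFv : F v = fun y => g y * Real.exp (v y) := by
    funext y
    simp only [hF]
    rw [hcl_id _ (hv0 y) ((hv1 y).trans (hbar y))]
  rw [hfix x, hFv]

/-- A bounded fixed point of the integral equation is a classical solution. -/
lemma isEntireSolution_of_fixedPoint {m : ℕ} (hm : 2 ≤ m) (hN : 2 * m < N)
    {P : MvPolynomial (Fin N) ℝ} (hdeg : P.totalDegree ≤ 2 * m - 2)
    (hP : IsRapid fun x : RN N => Real.exp (-polyValue P x)) {C : ℝ} {v : RN N → ℝ}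
    (hvc : Continuous v) (hv0 : ∀ x, 0 ≤ v x) (hv1 : ∀ x, v x ≤ 1)
    (hfix : ∀ x, v x = (rieszConst N m)⁻¹ * conv (bubble 0 ((N : ℝ) / 2 - m))
      (fun y => Real.exp (-polyValue P y - C + v y)) x) :
    IsEntireSolution m fun x => -polyValue P x - C + v x := by
  have h1 : (2 : ℝ) * m < N := by exact_mod_cast hN
  have h2 : (2 : ℝ) ≤ m := by exact_mod_cast hm
  set Q : MvPolynomial (Fin N) ℝ := -P - MvPolynomial.C C with hQ
  have hQv : ∀ x : RN N, polyValue Q x = -polyValue P x - C := fun x => by simp [hQ, polyValue]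
  simp_rw [← hQv] at hfix ⊢
  have hFr : IsRapid fun x => Real.exp (polyValue Q x + v x) := by
    intro p
    refine ((isSlow_const (Real.exp (1 - C))).mul_rapid hP p).of_abs_le fun x => ?_
    rw [abs_of_pos (Real.exp_pos _), ← Real.exp_add, abs_of_pos (Real.exp_pos _), hQv]
    exact Real.exp_le_exp.2 (by linarith [hv1 x])
  -- Bootstrap: k derivatives of v give k rapidly decaying derivatives of the source, and its
  -- potential has k + 1. The condition 2s + 1 < N reads 2m > 1.
  have hsm : ∀ k, SlowSmooth k v := by
    intro k
    induction k with
    | zero =>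
      refine ⟨hvc, 0, 1, fun x => ?_⟩
      rw [abs_of_nonneg (hv0 x)]
      simpa using hv1 x
    | succ k ih =>
      have hF := rapidSmooth_exp ((slowSmooth_polyValue k Q).add ih) hFr
      have h3 := (slowSmooth_succ_conv_bubble_zero (s := (N : ℝ) / 2 - m) (by linarith)
        (by linarith) hF).const_mul (rieszConst N m)⁻¹
      rw [funext hfix]
      exact h3
  have hF := rapidSmooth_exp ((slowSmooth_polyValue (2 * m) Q).add (hsm (2 * m))) hFr
  have hK := weightIntegrable_bubble_zero (N := N) (s := (N : ℝ) / 2 - m) (by linarith)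
    (by linarith)
  have hpolyQ : polyharmonic m (polyValue Q) = fun _ => 0 := by
    refine polyharmonic_polyValue_eq_zero Q fun t ht => ?_
    have hc : MvPolynomial.coeff t P = 0 := by
      refine MvPolynomial.coeff_eq_zero_of_totalDegree_lt ?_
      have h4 : ∑ i ∈ t.support, t i = t.degree := rfl
      omega
    -- The constant C contributes to Q only in degree 0, below 2m.
    have ht0 : (0 : Fin N →₀ ℕ) ≠ t := by
      rintro rfl
      simp only [map_zero] at ht
      omega
    rw [hQ, MvPolynomial.coeff_sub, MvPolynomial.coeff_neg, hc, MvPolynomial.coeff_C, if_neg ht0]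
    simp
  have hpolyv : polyharmonic m v = fun x => Real.exp (polyValue Q x + v x) := by
    conv_lhs => rw [funext hfix]
    rw [polyharmonic_const_mul _ (hK.slowSmooth_conv hF), hK.polyharmonic_conv hF,
      conv_bubble_zero_polyharmonic (by omega) hN hF]
    funext x
    rw [← mul_assoc, inv_mul_cancel₀ (rieszConst_pos (by omega) hN).ne', one_mul]
  refine ⟨((slowSmooth_polyValue (2 * m) Q).add (hsm (2 * m))).contDiff, fun x => ?_⟩
  rw [polyharmonic_add (slowSmooth_polyValue (2 * m) Q) (hsm (2 * m)), hpolyQ, hpolyv]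
  exact zero_add _

lemma exists_forall_isEntireSolution_isTrapped {m : ℕ} (hm : 2 ≤ m) (hN : 2 * m < N)
    {P : MvPolynomial (Fin N) ℝ} (hdeg : P.totalDegree ≤ 2 * m - 2)
    (hP : IsRapid fun x : RN N => Real.exp (-polyValue P x)) :
    ∃ C_P : ℝ, ∀ C : ℝ, C_P ≤ C → ∃ u : RN N → ℝ, IsEntireSolution m u ∧ IsTrapped m P C u := by
  have h1 : (2 : ℝ) * m < N := by exact_mod_cast hN
  have h2 : (2 : ℝ) ≤ m := by exact_mod_cast hm
  set s : ℝ := (N : ℝ) / 2 - m with hs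
  obtain ⟨A, hA0, hA⟩ := exists_abs_conv_bubble_zero_le (N := N) (s := s) (by linarith)
    (by linarith)
  obtain ⟨D, hD0, hD⟩ := (hP (-(2 * s + N + 1))).exists_nonneg
  have hκ : 0 < (rieszConst N m)⁻¹ := inv_pos.2 (rieszConst_pos (by omega) hN)
  set κ : ℝ := (rieszConst N m)⁻¹ with hκ_def
  -- Chosen so that with δ = e^{-C} D the smallness condition of the fixed point lemma becomes
  -- e^{-C} M ≤ 1, which C ≥ log(M + 1) ensures; adding 1 keeps the logarithm meaningful when M = 0.
  set M : ℝ := 2 * (κ * (Real.exp 1 * D * A)) with hM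
  have hM0 : 0 ≤ M := by positivity
  refine ⟨Real.log (M + 1), fun C hC => ?_⟩
  have hexpC : Real.exp (-C) * M ≤ 1 := by
    have h3 : M + 1 ≤ Real.exp C := by
      rw [← Real.exp_log (by linarith : 0 < M + 1)]
      exact Real.exp_le_exp.2 hC
    rw [Real.exp_neg, inv_mul_le_iff₀ (Real.exp_pos C)]
    linarith
  have hcont := (slowSmooth_polyValue 0 P).continuous
  obtain ⟨v, hvc, hv0, hv1, hfix⟩ := exists_fixedPoint_conv (N := N) (s := s) (A := A) (κ := κ)
    (δ := Real.exp (-C) * D) (by linarith) (by linarith) hκ.le hA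
    (g := fun x => Real.exp (-C) * Real.exp (-polyValue P x))
    (continuous_const.mul (Real.continuous_exp.comp hcont.neg)) (fun x => by positivity)
    ((isSlow_const _).mul_rapid hP) (fun y => by
      have := hD y
      rw [abs_of_pos (Real.exp_pos _)] at this
      rw [mul_assoc]
      exact mul_le_mul_of_nonneg_left this (Real.exp_pos _).le) (by
      calc κ * (Real.exp 1 * (Real.exp (-C) * D) * A) = Real.exp (-C) * M / 2 := by
            rw [hM]; ring
        _ ≤ 1 / 2 := by linarith)
  have hbar : ∀ x : RN N, (1 + ‖x‖ ^ 2) ^ (-s) ≤ 1 := fun x =>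
    Real.rpow_le_one_of_one_le_of_nonpos (by nlinarith [sq_nonneg ‖x‖]) (by linarith)
  refine ⟨fun x => -polyValue P x - C + v x, ?_, fun x => ⟨by linarith [hv0 x], ?_⟩⟩
  · refine isEntireSolution_of_fixedPoint hm hN hdeg hP hvc hv0
      (fun x => (hv1 x).trans (hbar x)) fun x => ?_
    rw [hfix x]
    congr 3
    funext y
    rw [← Real.exp_add, ← Real.exp_add]
    congr 1
    ring
  · have := hv1 x
    rw [show (m : ℝ) - (N : ℝ) / 2 = -s by rw [hs]; ring]
    linarith

end existence

/-! ### Hardy–Rellich inequalities and stability -/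

section stability

variable {f g ψ : RN N → ℝ}

lemma integrable_slow_mul_rapid (hg : SlowSmooth 0 g) (hf : RapidSmooth 0 f) :
    Integrable fun x => g x * f x :=
  (hg.2.mul_rapid hf.2).integrable (hg.1.mul hf.1)

lemma integral_mul_pd (hg : SlowSmooth 1 g) (hf : RapidSmooth 1 f) (i : Fin N) :
    ∫ x, g x * pd i f x = -∫ x, pd i g x * f x :=
  integral_mul_fderiv_eq_neg_fderiv_mul_of_integrable
    (integrable_slow_mul_rapid (hg.2 i) hf.of_succ)
    (integrable_slow_mul_rapid hg.of_succ (hf.2 i))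
    (integrable_slow_mul_rapid hg.of_succ hf.of_succ)
    (fun x _ => hg.differentiable x) (fun x _ => hf.differentiable x)

lemma integral_mul_laplacian (hg : SlowSmooth 2 g) (hf : RapidSmooth 2 f) :
    ∫ x, g x * (Δ f) x = ∫ x, (Δ g) x * f x := by
  rw [laplacian_eq_sum_pd hf.contDiff, laplacian_eq_sum_pd hg.contDiff]
  simp_rw [Finset.mul_sum, Finset.sum_mul]
  rw [integral_finsetSum _ fun i _ =>
      integrable_slow_mul_rapid (hg.of_le (Nat.zero_le _)) ((hf.2 i).2 i),
    integral_finsetSum _ fun i _ =>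
      integrable_slow_mul_rapid ((hg.2 i).2 i) (hf.of_le (Nat.zero_le _))]
  refine Finset.sum_congr rfl fun i _ => ?_
  rw [integral_mul_pd hg.of_succ (hf.2 i), integral_mul_pd (hg.2 i) hf.of_succ, neg_neg]

/-- The difference of the two sides is 2|∇ψ|². -/
lemma two_mul_mul_laplacian_le (hψ : RapidSmooth 2 ψ) (x : RN N) :
    2 * ψ x * (Δ ψ) x ≤ (Δ fun y => ψ y * ψ y) x := by
  have hd := hψ.differentiable
  have hsq : RapidSmooth 2 fun y => ψ y * ψ y := RapidSmooth.mul_slow hψ (RapidSmooth.slow hψ)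
  rw [laplacian_eq_sum_pd hψ.contDiff, laplacian_eq_sum_pd hsq.contDiff, Finset.mul_sum]
  refine Finset.sum_le_sum fun i _ => ?_
  have hdi : Differentiable ℝ (pd i ψ) := (hψ.2 i).differentiable
  rw [pd_mul hd hd, pd_add (f := fun x => ψ x * pd i ψ x) (g := fun x => pd i ψ x * ψ x)
    (hd.mul hdi) (hdi.mul hd), pd_mul hd hdi, pd_mul hdi hd]
  nlinarith [sq_nonneg (pd i ψ x)]

lemma bubble_one_eq_mul (s : ℝ) (x : RN N) :
    bubble 1 s x = (‖x‖ ^ 2 + 1) * bubble 1 (s + 1) x := by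
  have := normSq_mul_bubble one_pos s x
  linarith

/-- Weighted Rellich inequality. -/
lemma exists_integral_bubble_mul_sq_le {t : ℝ} (ht : 0 ≤ t) (htN : t + 2 < N / 2) :
    ∃ A : ℝ, 0 ≤ A ∧ ∀ ψ : RN N → ℝ, RapidSmooth 2 ψ →
      ∫ x, bubble 1 (t + 2) x * ψ x ^ 2 ≤ A * ∫ x, bubble 1 t x * (Δ ψ) x ^ 2 := by
  -- The leading coefficient of `neg_laplacian_bubble` at exponent t + 1; it is positive exactly
  -- because t + 2 < N/2.
  set c : ℝ := 4 * (t + 1) * (N / 2 - (t + 1) - 1) with hc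
  have hc0 : 0 < c := mul_pos (by positivity) (by linarith)
  refine ⟨4 / c ^ 2, by positivity, fun ψ hψ => ?_⟩
  have hψ0 : RapidSmooth 0 ψ := hψ.of_le (Nat.zero_le _)
  have hsq : RapidSmooth 2 fun y => ψ y * ψ y := RapidSmooth.mul_slow hψ (RapidSmooth.slow hψ)
  have hΔ : RapidSmooth 0 (Δ ψ) := RapidSmooth.laplacian hψ
  have hW : ∀ r : ℝ, 0 ≤ r → ∀ k, SlowSmooth k (bubble (N := N) 1 r) :=
    fun r hr k => slowSmooth_bubble one_pos hr k
  have hi1 : Integrable fun x => bubble 1 (t + 2) x * ψ x ^ 2 := by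
    simp_rw [pow_two]
    exact integrable_slow_mul_rapid (hW _ (by linarith) 0) (hsq.of_le (Nat.zero_le _))
  have hi2 : Integrable fun x => bubble 1 t x * (Δ ψ) x ^ 2 := by
    simp_rw [pow_two]
    exact integrable_slow_mul_rapid (hW _ ht 0) (RapidSmooth.mul_slow hΔ (RapidSmooth.slow hΔ))
  have hi3 : Integrable fun x => -(Δ (bubble (N := N) 1 (t + 1))) x * (ψ x * ψ x) :=
    integrable_slow_mul_rapid (SlowSmooth.neg_laplacian (hW _ (by linarith) 2))
      (hsq.of_le (Nat.zero_le _))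
  have hi4 : Integrable fun x => bubble 1 (t + 1) x * (Δ fun y => ψ y * ψ y) x :=
    integrable_slow_mul_rapid (hW _ (by linarith) 0) (RapidSmooth.laplacian hsq)
  have h1 : c * ∫ x, bubble 1 (t + 2) x * ψ x ^ 2 ≤
      ∫ x, -(Δ (bubble (N := N) 1 (t + 1))) x * (ψ x * ψ x) := by
    rw [← integral_const_mul]
    refine integral_mono (hi1.const_mul c) hi3 fun x => ?_
    have h := congrFun (neg_laplacian_bubble (N := N) (s := t + 1) one_pos (by linarith)) x
    simp only at h ⊢
    rw [h, show t + 1 + 1 = t + 2 by ring, hc]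
    have h2 : 0 ≤ 4 * (t + 1) * (t + 2) * 1 * bubble 1 (t + 1 + 2) x :=
      mul_nonneg (by positivity) (bubble_pos one_pos _ x).le
    nlinarith [mul_nonneg h2 (mul_self_nonneg (ψ x))]
  have h2 : ∫ x, -(Δ (bubble (N := N) 1 (t + 1))) x * (ψ x * ψ x) =
      -∫ x, bubble 1 (t + 1) x * (Δ fun y => ψ y * ψ y) x := by
    rw [integral_mul_laplacian (hW _ (by linarith) 2) hsq, ← integral_neg]
    simp_rw [neg_mul]
  -- Replace Δ(ψ²) by its lower bound 2ψΔψ and apply Young's inequality, the weight of index t + 1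
  -- being the geometric mean of those of indices t and t + 2. The c/2 term is absorbed on the left,
  -- which leaves the constant 4/c².
  have h3 : -∫ x, bubble 1 (t + 1) x * (Δ fun y => ψ y * ψ y) x ≤
      ∫ x, (c / 2 * (bubble 1 (t + 2) x * ψ x ^ 2) + 2 / c * (bubble 1 t x * (Δ ψ) x ^ 2)) := by
    rw [← integral_neg]
    refine integral_mono hi4.neg ((hi1.const_mul _).add (hi2.const_mul _)) fun x => ?_
    have h5 := two_mul_mul_laplacian_le hψ x
    have h6 : bubble 1 (t + 1) x = (‖x‖ ^ 2 + 1) * bubble 1 (t + 2) x := by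
      rw [bubble_one_eq_mul, show t + 1 + 1 = t + 2 by ring]
    have h7 : bubble 1 t x = (‖x‖ ^ 2 + 1) ^ 2 * bubble 1 (t + 2) x := by
      rw [bubble_one_eq_mul, h6]; ring
    have hw := bubble_pos (N := N) one_pos (t + 2) x
    simp only
    rw [h7, h6]
    generalize (Δ fun y => ψ y * ψ y) x = Z at h5 ⊢
    generalize (Δ ψ) x = L at h5 ⊢
    generalize bubble 1 (t + 2) x = w at hw ⊢
    have hq : 0 < ‖x‖ ^ 2 + 1 := by positivity
    generalize ‖x‖ ^ 2 + 1 = q at hq ⊢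
    have h8 : q * w * (2 * ψ x * L) ≤ q * w * Z := mul_le_mul_of_nonneg_left h5 (by positivity)
    have h9 : 0 ≤ c / 2 * w * (ψ x + 2 / c * q * L) ^ 2 := by positivity
    have h10 : c / 2 * w * (ψ x + 2 / c * q * L) ^ 2 =
        c / 2 * (w * ψ x ^ 2) + 2 / c * (q ^ 2 * w * L ^ 2) + q * w * (2 * ψ x * L) := by
      field_simp
      ring
    linarith
  rw [integral_add (hi1.const_mul _) (hi2.const_mul _), integral_const_mul,
    integral_const_mul] at h3
  rw [div_mul_eq_mul_div, le_div_iff₀ (by positivity)]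
  have h4 : c / 2 * ∫ x, bubble 1 (t + 2) x * ψ x ^ 2 ≤
      2 / c * ∫ x, bubble 1 t x * (Δ ψ) x ^ 2 := by linarith
  rw [div_mul_eq_mul_div 2 c, le_div_iff₀ hc0] at h4
  nlinarith

/-- Hardy's inequality with a regularised weight. -/
lemma exists_integral_bubble_one_mul_sq_le (hN : 2 < N) :
    ∃ A : ℝ, 0 ≤ A ∧ ∀ ψ : RN N → ℝ, RapidSmooth 1 ψ →
      ∫ x, bubble 1 1 x * ψ x ^ 2 ≤ A * ∫ x, ∑ i, pd i ψ x ^ 2 := by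
  have hN' : (2 : ℝ) < N := by exact_mod_cast hN
  set c : ℝ := N - 2 with hc
  have hc0 : 0 < c := by linarith
  refine ⟨4 / c ^ 2, by positivity, fun ψ hψ => ?_⟩
  have hψ0 : RapidSmooth 0 ψ := hψ.of_succ
  have hsq : RapidSmooth 1 fun y => ψ y * ψ y := RapidSmooth.mul_slow hψ (RapidSmooth.slow hψ)
  -- The vector field x/(1 + |x|²) has divergence at least (N - 2)/(1 + |x|²) and squared length at
  -- most 1/(1 + |x|²). Testing it against ψ² and using Young's inequality gives Hardy's inequality.
  set g : Fin N → RN N → ℝ := fun i x => x i * bubble 1 1 x with hg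
  have hgs : ∀ i, SlowSmooth 1 (g i) := fun i =>
    (slowSmooth_coord i).mul (slowSmooth_bubble one_pos zero_le_one 1)
  have hi1 : Integrable fun x => bubble 1 1 x * ψ x ^ 2 := by
    simp_rw [pow_two]
    exact integrable_slow_mul_rapid (slowSmooth_bubble one_pos zero_le_one 0) hsq.of_succ
  have hi2 : Integrable fun x => ∑ i, pd i ψ x ^ 2 := by
    refine integrable_finsetSum _ fun i _ => ?_
    simp_rw [pow_two]
    exact integrable_slow_mul_rapid (RapidSmooth.slow (hψ.2 i)) (hψ.2 i)
  have hi3 : ∀ i, Integrable fun x => pd i (g i) x * (ψ x * ψ x) := fun i =>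
    integrable_slow_mul_rapid ((hgs i).2 i) hsq.of_succ
  have hi4 : ∀ i, Integrable fun x => g i x * pd i (fun y => ψ y * ψ y) x := fun i =>
    integrable_slow_mul_rapid (hgs i).of_succ (hsq.2 i)
  have hsum : ∑ i, ∫ x, pd i (g i) x * (ψ x * ψ x) =
      -∑ i, ∫ x, g i x * pd i (fun y => ψ y * ψ y) x := by
    rw [← Finset.sum_neg_distrib]
    refine Finset.sum_congr rfl fun i _ => ?_
    rw [integral_mul_pd (hgs i) hsq, neg_neg]
  rw [← integral_finsetSum _ fun i _ => hi3 i, ← integral_finsetSum _ fun i _ => hi4 i,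
    ← integral_neg] at hsum
  have h1 : c * ∫ x, bubble 1 1 x * ψ x ^ 2 ≤ ∫ x, ∑ i, pd i (g i) x * (ψ x * ψ x) := by
    rw [← integral_const_mul]
    refine integral_mono (hi1.const_mul c) (integrable_finsetSum _ fun i _ => hi3 i) fun x => ?_
    have h2 : ∀ i, pd i (g i) x = bubble 1 1 x - 2 * bubble 1 2 x * x i ^ 2 := by
      intro i
      rw [hg, pd_mul (differentiable_coord i) (differentiable_bubble one_pos _),
        pd_bubble one_pos, pd_coord]
      simp only [if_true]
      rw [show (1 : ℝ) + 1 = 2 by norm_num]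
      ring
    have h3 := normSq_mul_bubble one_pos 1 x
    rw [show (1 : ℝ) + 1 = 2 by norm_num] at h3
    have h4 := bubble_pos (N := N) one_pos 2 x
    simp only
    rw [← Finset.sum_mul]
    simp_rw [h2]
    rw [Finset.sum_sub_distrib, ← Finset.mul_sum, ← EuclideanSpace.real_norm_sq_eq]
    simp only [Finset.sum_const, Finset.card_univ, Fintype.card_fin, nsmul_eq_mul]
    have h5 : (N : ℝ) * bubble 1 1 x - 2 * bubble 1 2 x * ‖x‖ ^ 2 =
        c * bubble 1 1 x + 2 * bubble 1 2 x := by rw [hc]; linarith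
    rw [h5]
    nlinarith [mul_nonneg h4.le (mul_self_nonneg (ψ x))]
  have h3 : ∫ x, -∑ i, g i x * pd i (fun y => ψ y * ψ y) x ≤
      ∫ x, (c / 2 * (bubble 1 1 x * ψ x ^ 2) + 2 / c * ∑ i, pd i ψ x ^ 2) := by
    refine integral_mono (integrable_finsetSum _ fun i _ => hi4 i).neg
      ((hi1.const_mul _).add (hi2.const_mul _)) fun x => ?_
    have hw := bubble_pos (N := N) one_pos 1 x
    have h4 : ∀ i, -(g i x * pd i (fun y => ψ y * ψ y) x) ≤
        c / 2 * (bubble 1 1 x * ψ x) ^ 2 * x i ^ 2 + 2 / c * pd i ψ x ^ 2 := by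
      intro i
      rw [pd_mul hψ.differentiable hψ.differentiable]
      simp only [hg]
      have h9 : 0 ≤ c / 2 * (bubble 1 1 x * ψ x * x i + 2 / c * pd i ψ x) ^ 2 := by positivity
      have h10 : c / 2 * (bubble 1 1 x * ψ x * x i + 2 / c * pd i ψ x) ^ 2 =
          c / 2 * (bubble 1 1 x * ψ x) ^ 2 * x i ^ 2 + 2 / c * pd i ψ x ^ 2 +
            x i * bubble 1 1 x * (ψ x * pd i ψ x + pd i ψ x * ψ x) := by
        field_simp
        ring
      linarith
    have h5 := Finset.sum_le_sum fun i (_ : i ∈ Finset.univ) => h4 i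
    rw [Finset.sum_add_distrib, ← Finset.mul_sum, ← Finset.mul_sum,
      ← EuclideanSpace.real_norm_sq_eq, Finset.sum_neg_distrib] at h5
    have h6 : bubble 1 1 x * ‖x‖ ^ 2 ≤ 1 := by
      have := normSq_mul_bubble one_pos 0 x
      rw [zero_add] at this
      have h0 : bubble 1 0 x = 1 := by simp [bubble]
      rw [h0] at this
      linarith
    have h7 : c / 2 * (bubble 1 1 x * ψ x) ^ 2 * ‖x‖ ^ 2 ≤ c / 2 * (bubble 1 1 x * ψ x ^ 2) := by
      have h8 : 0 ≤ c / 2 * (bubble 1 1 x * ψ x ^ 2) := by positivity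
      calc c / 2 * (bubble 1 1 x * ψ x) ^ 2 * ‖x‖ ^ 2
          = c / 2 * (bubble 1 1 x * ψ x ^ 2) * (bubble 1 1 x * ‖x‖ ^ 2) := by ring
        _ ≤ c / 2 * (bubble 1 1 x * ψ x ^ 2) * 1 := mul_le_mul_of_nonneg_left h6 h8
        _ = _ := mul_one _
    exact h5.trans (by linarith)
  rw [integral_add (hi1.const_mul _) (hi2.const_mul _), integral_const_mul,
    integral_const_mul] at h3
  rw [div_mul_eq_mul_div, le_div_iff₀ (by positivity)]
  have h4 : c / 2 * ∫ x, bubble 1 1 x * ψ x ^ 2 ≤ 2 / c * ∫ x, ∑ i, pd i ψ x ^ 2 := by linarith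
  rw [div_mul_eq_mul_div 2 c, le_div_iff₀ hc0] at h4
  nlinarith

lemma iterLaplacian_succ (k : ℕ) (f : RN N → ℝ) :
    iterLaplacian (k + 1) f = iterLaplacian k (Δ f) := rfl

lemma RapidSmooth.iterLaplacian {n k : ℕ} (hf : RapidSmooth (n + 2 * k) f) :
    RapidSmooth n (iterLaplacian k f) := by
  induction k generalizing f with
  | zero => exact hf
  | succ k ih => exact ih (RapidSmooth.laplacian hf)

/-- Iterated weighted Rellich: each step lowers the weight index by 2 and replaces ψ by Δψ. Every
intermediate index stays below N/2, so each step is admissible. -/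
lemma exists_integral_bubble_mul_sq_le_iterLaplacian {t : ℝ} (ht : 0 ≤ t) (j : ℕ)
    (htN : t + 2 * j < N / 2) :
    ∃ A : ℝ, 0 ≤ A ∧ ∀ ψ : RN N → ℝ, RapidSmooth (2 * j) ψ →
      ∫ x, bubble 1 (t + 2 * j) x * ψ x ^ 2 ≤
        A * ∫ x, bubble 1 t x * iterLaplacian j ψ x ^ 2 := by
  induction j with
  | zero => exact ⟨1, zero_le_one, fun ψ _ => by simp [iterLaplacian]⟩
  | succ j ih =>
    push_cast at htN
    obtain ⟨A, hA0, hA⟩ := ih (by linarith)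
    obtain ⟨B, hB0, hB⟩ := exists_integral_bubble_mul_sq_le (N := N) (t := t + 2 * j)
      (by positivity) (by linarith)
    refine ⟨B * A, by positivity, fun ψ hψ => ?_⟩
    have h1 := hB ψ (hψ.of_le (by omega))
    have h2 := hA (Δ ψ) (RapidSmooth.laplacian hψ)
    rw [show t + 2 * ((j + 1 : ℕ) : ℝ) = t + 2 * j + 2 by push_cast; ring, iterLaplacian_succ,
      mul_assoc]
    exact h1.trans (mul_le_mul_of_nonneg_left h2 hB0)

lemma norm_gradient_sq (f : RN N → ℝ) (x : RN N) :
    ‖gradient f x‖ ^ 2 = ∑ i, pd i f x ^ 2 := by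
  rw [EuclideanSpace.real_norm_sq_eq]
  refine Finset.sum_congr rfl fun i _ => ?_
  congr 1
  have h : inner ℝ (gradient f x) (EuclideanSpace.single i 1) = pd i f x := by
    rw [gradient, InnerProductSpace.toDual_symm_apply, pd]
  rw [← h, EuclideanSpace.inner_single_right]
  simp

/-- Hardy–Rellich inequality with a regularised weight. -/
lemma exists_integral_bubble_mul_sq_le_polyEnergy {m : ℕ} (hN : 2 * m < N) :
    ∃ A : ℝ, 0 ≤ A ∧ ∀ φ : RN N → ℝ, IsTestFunction Set.univ φ →
      ∫ x, bubble 1 m x * φ x ^ 2 ≤ A * polyEnergy m Set.univ φ := by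
  have h1 : (2 : ℝ) * m < N := by exact_mod_cast hN
  have hφ : ∀ φ : RN N → ℝ, IsTestFunction Set.univ φ → ∀ k, RapidSmooth k φ := fun φ h k =>
    rapidSmooth_of_hasCompactSupport (h.contDiff.of_le (by exact_mod_cast le_top))
      h.hasCompactSupport
  -- For even m the Rellich chain descends from index m to the trivial weight of index 0. For odd m
  -- it stops at index 1, where Hardy's inequality turns the last weight into a gradient.
  rcases Nat.even_or_odd m with hm | hm
  · obtain ⟨j, hj⟩ := hm
    have hmj : (m : ℝ) = 0 + 2 * j := by rw [hj]; push_cast; ring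
    obtain ⟨A, hA0, hA⟩ := exists_integral_bubble_mul_sq_le_iterLaplacian (N := N) (t := 0) le_rfl j
      (by linarith)
    refine ⟨A, hA0, fun φ hφt => ?_⟩
    have h2 := hA φ (hφ φ hφt _)
    rw [polyEnergy, if_pos ⟨j, hj⟩, hmj, show m / 2 = j by omega]
    simpa [bubble] using h2
  · obtain ⟨j, hj⟩ := hm
    have hmj : (m : ℝ) = 1 + 2 * j := by rw [hj]; push_cast; ring
    obtain ⟨A, hA0, hA⟩ := exists_integral_bubble_mul_sq_le_iterLaplacian (N := N) (t := 1)
      zero_le_one j (by linarith)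
    obtain ⟨B, hB0, hB⟩ := exists_integral_bubble_one_mul_sq_le (N := N) (by omega)
    refine ⟨A * B, by positivity, fun φ hφt => ?_⟩
    have h2 := hA φ (hφ φ hφt _)
    have h3 := hB (iterLaplacian j φ) (RapidSmooth.iterLaplacian (hφ φ hφt _))
    rw [polyEnergy, if_neg (Nat.not_even_iff_odd.2 ⟨j, hj⟩), hmj, show (m - 1) / 2 = j by omega]
    simp_rw [norm_gradient_sq]
    rw [Measure.restrict_univ, mul_assoc]
    exact h2.trans (mul_le_mul_of_nonneg_left h3 hA0)

lemma polyEnergy_nonneg (m : ℕ) (Ω : Set (RN N)) (φ : RN N → ℝ) : 0 ≤ polyEnergy m Ω φ := by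
  unfold polyEnergy
  split_ifs
  · exact integral_nonneg fun x => by positivity
  · exact integral_nonneg fun x => by positivity

/-- Only the upper bound u ≤ -P - C + 1 matters: it makes e^u at most e^{1-C} D (1 + |x|²)^{-m}, and
Hardy–Rellich with constant A absorbs this once e^{1-C} D A ≤ 1. The threshold therefore does not
depend on u. -/
lemma exists_forall_isStableIn {m : ℕ} (hN : 2 * m < N) {P : MvPolynomial (Fin N) ℝ}
    (hP : IsRapid fun x : RN N => Real.exp (-polyValue P x)) :
    ∃ C₀ : ℝ, ∀ C : ℝ, C₀ ≤ C → ∀ u : RN N → ℝ, Continuous u → IsTrapped m P C u →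
      IsStableIn m u Set.univ := by
  have h1 : (2 : ℝ) * m < N := by exact_mod_cast hN
  obtain ⟨A, hA0, hA⟩ := exists_integral_bubble_mul_sq_le_polyEnergy hN
  obtain ⟨D, hD0, hD⟩ := (hP (-(2 * m))).exists_nonneg
  set M : ℝ := Real.exp 1 * D * A with hM
  have hM0 : 0 ≤ M := by positivity
  refine ⟨Real.log (M + 1), fun C hC u hu htr φ hφ => ?_⟩
  have hexpC : Real.exp (-C) * M ≤ 1 := by
    have h3 : M + 1 ≤ Real.exp C := by
      rw [← Real.exp_log (by linarith : 0 < M + 1)]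
      exact Real.exp_le_exp.2 hC
    rw [Real.exp_neg, inv_mul_le_iff₀ (Real.exp_pos C)]
    linarith
  have hexpu : ∀ x, Real.exp (u x) ≤ Real.exp (-C) * Real.exp 1 * D * bubble 1 m x := by
    intro x
    have hbar : (1 + ‖x‖ ^ 2) ^ ((m : ℝ) - (N : ℝ) / 2) ≤ 1 :=
      Real.rpow_le_one_of_one_le_of_nonpos (by nlinarith [sq_nonneg ‖x‖]) (by linarith)
    have h2 := hD x
    rw [abs_of_pos (Real.exp_pos _)] at h2
    have h3 : (1 + ‖x‖) ^ (-(2 * (m : ℝ))) ≤ bubble 1 m x := by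
      rw [show -(2 * (m : ℝ)) = ((2 : ℕ) : ℝ) * (-m) by push_cast; ring,
        Real.rpow_mul (one_add_norm_pos x).le, Real.rpow_natCast]
      refine Real.rpow_le_rpow_of_nonpos (by positivity) ?_ (by simp)
      nlinarith [norm_nonneg x]
    calc Real.exp (u x) ≤ Real.exp (-C + 1 + -polyValue P x) :=
          Real.exp_le_exp.2 (by linarith [(htr x).2])
      _ = Real.exp (-C) * Real.exp 1 * Real.exp (-polyValue P x) := by
          rw [Real.exp_add, Real.exp_add]
      _ ≤ Real.exp (-C) * Real.exp 1 * (D * bubble 1 m x) := by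
          gcongr
          exact h2.trans (mul_le_mul_of_nonneg_left h3 hD0)
      _ = _ := by ring
  have hφc : Continuous fun x => φ x ^ 2 := hφ.contDiff.continuous.pow 2
  have hφs : HasCompactSupport fun x => φ x ^ 2 := by
    simp_rw [pow_two]
    exact hφ.hasCompactSupport.mul_right
  have hle : ∫ x, Real.exp (u x) * φ x ^ 2 ≤
      ∫ x, Real.exp (-C) * Real.exp 1 * D * (bubble 1 m x * φ x ^ 2) := by
    refine integral_mono
      (((Real.continuous_exp.comp hu).mul hφc).integrable_of_hasCompactSupport hφs.mul_left)
      ((((differentiable_bubble one_pos _).continuous.mul hφc).integrable_of_hasCompactSupport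
        hφs.mul_left).const_mul _) fun x => ?_
    simp only
    rw [← mul_assoc]
    exact mul_le_mul_of_nonneg_right (hexpu x) (sq_nonneg _)
  rw [integral_const_mul] at hle
  have h4 : Real.exp (-C) * Real.exp 1 * D * ∫ x, bubble 1 m x * φ x ^ 2 ≤
      polyEnergy m Set.univ φ := by
    have hE := polyEnergy_nonneg m Set.univ φ
    calc Real.exp (-C) * Real.exp 1 * D * ∫ x, bubble 1 m x * φ x ^ 2
        ≤ Real.exp (-C) * Real.exp 1 * D * (A * polyEnergy m Set.univ φ) := by
          gcongr
          exact hA φ hφ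
      _ = Real.exp (-C) * M * polyEnergy m Set.univ φ := by rw [hM]; ring
      _ ≤ 1 * polyEnergy m Set.univ φ := mul_le_mul_of_nonneg_right hexpC hE
      _ = _ := one_mul _
  rw [Measure.restrict_univ]
  linarith

end stability

end

theorem theorem3p2 (m N : ℕ) (hm : 2 ≤ m) (hN : 2 * m < N)
    (P : MvPolynomial (Fin N) ℝ) (hdeg : P.totalDegree ≤ 2 * m - 2)
    (hP : Filter.Tendsto (fun x : RN N => polyValue P x / Real.log ‖x‖)
      (Bornology.cobounded (RN N)) Filter.atTop) :
    ∃ C_P : ℝ,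
      (∀ C : ℝ, C_P ≤ C → ∃ u : RN N → ℝ, IsEntireSolution m u ∧ IsTrapped m P C u) ∧
      ∃ C_P' : ℝ, C_P ≤ C_P' ∧
        ∀ C : ℝ, C_P' ≤ C → ∀ u : RN N → ℝ, IsEntireSolution m u → IsTrapped m P C u →
          IsStableIn m u Set.univ := by
  have hrapid := isRapid_exp_neg_of_tendsto (slowSmooth_polyValue 0 P).continuous hP
  obtain ⟨C₁, h₁⟩ := exists_forall_isEntireSolution_isTrapped hm hN hdeg hrapid
  obtain ⟨C₂, h₂⟩ := exists_forall_isStableIn hN hrapid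
  -- The existence and stability thresholds come from unrelated estimates, hence the maximum.
  exact ⟨C₁, h₁, max C₁ C₂, le_max_left _ _, fun C hC u hu htr =>
    h₂ C ((le_max_right _ _).trans hC) u hu.contDiff.continuous htr⟩
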